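/- Work over $\mathbb{C}$. A conic in $\mathbb{P}^3$ is a plane curve of degree two, that is, the zero locus, in some plane $H\subset\mathbb{P}^3$, of a quadratic form not vanishing identically on $H$ (irreducible conics, unions of two distinct coplanar lines, and double lines, a double line being counted once, independently of $H$); it is called reducible if it is a union of two (possibly equal) lines. Let $X_1,\ldots,X_7$ be distinct points of $\mathbb{P}^3$ that are not all contained in one reducible conic, and assume that no line contains $X_1$ and at least four of the points $X_2,\ldots,X_7$. (Both conditions hold, in particular, if the seven distinct points are not contained in a union of two lines, skew or not.) Then for generic lines $L_2,\ldots,L_7$ through $X_2,\ldots,X_7$, respectively, that is, for all $(L_2,\ldots,L_7)$ in some nonempty Zariski-open subset, depending on $X_1,\ldots,X_7$, of the product of the six projective planes of lines through $X_2,\ldots,X_7$, there are only finitely many conics that pass through $X_1$ and meet each of $L_2,\ldots,L_7$. -/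

import Mathlib

/-- Complex projective three-space. -/
abbrev P3 : Type := Projectivization ℂ (Fin 4 → ℂ)

/-- The points of the projective subspace that is given by a linear subspace `L` of `ℂ⁴`.
Lines of `P3` are given by subspaces `L` of dimension two. -/
def pointsOf (L : Submodule ℂ (Fin 4 → ℂ)) : Set P3 := {p | p.submodule ≤ L}

/-- A conic curve in `P3`: the zero locus, in a plane `h₀ x₀ + h₁ x₁ + h₂ x₂ + h₃ x₃ = 0`, of a
quadratic form that does not vanish identically on the plane. So irreducible plane conics, unions
of two distinct coplanar lines, and (double) lines. A plane curve of degree two, as a cycle, is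
determined by its set of points, hence counting these sets is counting degree-two plane cycles. -/
def IsConic (β : Set P3) : Prop :=
  ∃ (h : Fin 4 → ℂ) (Q : QuadraticForm ℂ (Fin 4 → ℂ)),
    h ≠ 0 ∧ (∃ v : Fin 4 → ℂ, h ⬝ᵥ v = 0 ∧ Q v ≠ 0) ∧
      β = {p : P3 | ∀ v ∈ p.submodule, h ⬝ᵥ v = 0 ∧ Q v = 0}

/-- A reducible conic: a conic curve that is the union of two (possibly equal) lines. -/
def IsReducibleConic (β : Set P3) : Prop :=
  IsConic β ∧ ∃ E E' : Submodule ℂ (Fin 4 → ℂ),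
    Module.finrank ℂ E = 2 ∧ Module.finrank ℂ E' = 2 ∧ β = pointsOf E ∪ pointsOf E'

/-- The lines of `P3` through the point `p` (they form a projective plane `ℙ(ℂ⁴ / p)`). -/
def LinesThrough (p : P3) : Type :=
  {L : Submodule ℂ (Fin 4 → ℂ) // Module.finrank ℂ L = 2 ∧ p ∈ pointsOf L}

/-- The open sets of the Zariski topology on the variety `∏ i, ℙ(ℂ⁴ / P i)` of tuples of lines
`L i` through given points `P i`. A tuple is described by homogeneous coordinate vectors `Y i` of
points on the lines `L i`; a basic open set is the set of the tuples on which a polynomial `F` in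
these coordinates does not vanish identically, and an open set is a union of basic ones.
(A multihomogeneous polynomial `G` on the product of the spaces `ℂ⁴ / P i` pulls back to such an
`F`, with `F ≠ 0` at `Y` exactly when `G ≠ 0` at the tuple; conversely, writing
`Y i = a i • P i + b i • Z i`, the condition on `L` is that some coefficient of `F` as a polynomial
in the `a i`, `b i` is nonzero, and these coefficients are polynomials in the `Z i`.) -/
def IsZariskiOpen {n : ℕ} (P : Fin n → P3) (U : Set ((i : Fin n) → LinesThrough (P i))) : Prop :=
  ∃ 𝓕 : Set (MvPolynomial (Fin n × Fin 4) ℂ),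
    U = {L | ∃ F ∈ 𝓕, ∃ Y : Fin n → Fin 4 → ℂ,
      (∀ i, Y i ∈ (L i).val) ∧ MvPolynomial.eval (fun k => Y k.1 k.2) F ≠ 0}

/-! The proof is a dimension count, stratified by the points that lie on the conic. Write `O` for
the first point and `P i` for the other six. A line through `P i` is met automatically if `P i` lies
on the conic, and otherwise imposes one condition. So it suffices to cover the conics through `O` by
finitely many families, each with at most as many parameters as its members miss points `P i`.

Conics without lines through `O` and 0, 1 or 2 prescribed `P i` have 6, 4 or 2 parameters, and four
prescribed `P i` leave at most one conic (`genericallyFinite_lineFree`). Pairs of coplanar lines `E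
∋ O` and `E'` have 5 parameters, or 3 if `E` contains a prescribed point, or 1 if also `E'` contains
one off `E`, or if `E'` avoids `O` and contains two (`genericallyFinite_linePairs`). The hypotheses
serve only this second case: some point is always missed, and at least three are missed when all
points on the pair lie on a line through `O`.

No dimension theory of varieties is needed. Every family has polynomial charts, and incidence with
`n` lines becomes a system of `4n` polynomial equations in `d + 3n` unknowns. For `d ≤ n`,
`exists_polynomial_finite_fibre` gives finitely many solutions off a hypersurface. -/

/-! ### Finite fibres of polynomial maps -/

/-- A system of polynomials in at least as many polynomials as variables has finite fibres over
all points outside of some hypersurface. -/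
theorem exists_polynomial_finite_fibre {σ τ : Type} [Fintype σ] [Fintype τ]
    (hcard : Fintype.card σ ≤ Fintype.card τ) (f : τ → MvPolynomial σ ℂ) :
    ∃ F : MvPolynomial τ ℂ, F ≠ 0 ∧ ∀ y : τ → ℂ, MvPolynomial.eval y F ≠ 0 →
      {x : σ → ℂ | ∀ t, MvPolynomial.eval x (f t) = y t}.Finite := by
  classical
  have hG : ∀ j : σ, ∃ G : MvPolynomial (Option τ) ℂ, G ≠ 0 ∧
      MvPolynomial.aeval (fun o : Option τ => o.elim (MvPolynomial.X j) f) G = 0 := by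
    intro j
    -- The polynomial ring has transcendence degree `card σ`, so `X j` together with all the `f t`
    -- is at least one element too many to be independent.
    by_contra! hcon
    have hind : AlgebraicIndependent ℂ
        (fun o : Option τ => o.elim (MvPolynomial.X j : MvPolynomial σ ℂ) f) := by
      rw [algebraicIndependent_iff]
      intro p hp
      by_contra hne
      exact hcon p hne hp
    have := hind.lift_cardinalMk_le_trdeg
    rw [MvPolynomial.trdeg_of_isDomain] at this
    simp only [Cardinal.mk_fintype, Fintype.card_option, Cardinal.lift_natCast] at this
    have h2 : Fintype.card τ + 1 ≤ Fintype.card σ := by exact_mod_cast this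
    omega
  choose G hG0 hG using hG
  set R : σ → Polynomial (MvPolynomial τ ℂ) :=
    fun j => MvPolynomial.optionEquivLeft ℂ τ (G j) with hR
  have hR0 : ∀ j, R j ≠ 0 := fun j => by
    simpa [hR] using hG0 j
  -- The relation for `X j`, specialised at `y`, stays nonzero where its leading coefficient in `X
  -- j` does, and then leaves finitely many values for `x j`.
  refine ⟨∏ j, (R j).leadingCoeff, ?_, ?_⟩
  · exact Finset.prod_ne_zero_iff.mpr fun j _ => Polynomial.leadingCoeff_ne_zero.mpr (hR0 j)
  · intro y hy
    rw [map_prod, Finset.prod_ne_zero_iff] at hy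
    have hS : ∀ j, (R j).map (MvPolynomial.eval y) ≠ 0 := by
      intro j h0
      apply hy j (Finset.mem_univ j)
      have := congrArg (fun p => Polynomial.coeff p (R j).natDegree) h0
      simpa [Polynomial.coeff_map] using this
    refine (Set.Finite.pi' (fun j => ((R j).map (MvPolynomial.eval y)).roots.toFinset.finite_toSet)).subset ?_
    intro x hx j
    simp only [Finset.mem_coe, Multiset.mem_toFinset, Polynomial.mem_roots (hS j),
      Polynomial.IsRoot.def]
    rw [← MvPolynomial.optionEquivLeft_elim_eval]
    have h1 := congrArg (MvPolynomial.eval x) (hG j)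
    rw [map_zero, ← MvPolynomial.coe_aeval_eq_eval, RingHom.coe_coe,
      ← AlgHom.comp_apply, MvPolynomial.comp_aeval] at h1
    rw [← h1, ← MvPolynomial.coe_aeval_eq_eval, RingHom.coe_coe]
    congr 2
    funext o
    cases o with
    | none => simp
    | some t => simpa using (hx t).symm

/-! ### Polynomial maps and generic finiteness -/

/-- A function on `ℂ^σ` that is given by a polynomial. -/
def IsPolyFun {σ : Type} (f : (σ → ℂ) → ℂ) : Prop :=
  ∃ P : MvPolynomial σ ℂ, ∀ x, MvPolynomial.eval x P = f x

/-- A vector-valued function on `ℂ^σ` all of whose coordinates are given by polynomials. -/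
def IsPolyMap {σ ι : Type} (f : (σ → ℂ) → ι → ℂ) : Prop := ∀ i, IsPolyFun fun x => f x i

namespace IsPolyFun
variable {σ : Type} {f g : (σ → ℂ) → ℂ}

theorem const (c : ℂ) : IsPolyFun fun _ : σ → ℂ => c := ⟨MvPolynomial.C c, fun x => by simp⟩

theorem coord (j : σ) : IsPolyFun fun x : σ → ℂ => x j := ⟨MvPolynomial.X j, fun x => by simp⟩

theorem add (hf : IsPolyFun f) (hg : IsPolyFun g) : IsPolyFun fun x => f x + g x := by
  obtain ⟨P, hP⟩ := hf
  obtain ⟨R, hR⟩ := hg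
  exact ⟨P + R, fun x => by simp [hP, hR]⟩

theorem mul (hf : IsPolyFun f) (hg : IsPolyFun g) : IsPolyFun fun x => f x * g x := by
  obtain ⟨P, hP⟩ := hf
  obtain ⟨R, hR⟩ := hg
  exact ⟨P * R, fun x => by simp [hP, hR]⟩

theorem reindex {ρ : Type} (e : σ → ρ) (hf : IsPolyFun f) :
    IsPolyFun fun x : ρ → ℂ => f fun j => x (e j) := by
  obtain ⟨P, hP⟩ := hf
  exact ⟨MvPolynomial.rename e P, fun x => by
    rw [MvPolynomial.eval_rename, hP]; rfl⟩

end IsPolyFun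

namespace IsPolyMap
variable {σ ι : Type} {f g : (σ → ℂ) → ι → ℂ} {c : (σ → ℂ) → ℂ}

theorem const (v : ι → ℂ) : IsPolyMap fun _ : σ → ℂ => v := fun i => IsPolyFun.const (v i)

theorem add (hf : IsPolyMap f) (hg : IsPolyMap g) : IsPolyMap fun x => f x + g x :=
  fun i => (hf i).add (hg i)

theorem smul (hc : IsPolyFun c) (hf : IsPolyMap f) : IsPolyMap fun x => c x • f x :=
  fun i => hc.mul (hf i)

theorem reindex {ρ : Type} (e : σ → ρ) (hf : IsPolyMap f) :
    IsPolyMap fun x : ρ → ℂ => f fun j => x (e j) := fun i => (hf i).reindex e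

end IsPolyMap

/-- A set that depends on a tuple of vectors is finite for all tuples outside of a hypersurface. -/
def GenericallyFinite {ι α : Type} (𝒞 : (ι → Fin 4 → ℂ) → Set α) : Prop :=
  ∃ F : MvPolynomial (ι × Fin 4) ℂ, F ≠ 0 ∧
    ∀ Y : ι → Fin 4 → ℂ, MvPolynomial.eval (fun k => Y k.1 k.2) F ≠ 0 → (𝒞 Y).Finite

namespace GenericallyFinite
variable {ι α : Type} {𝒞 𝒟 : (ι → Fin 4 → ℂ) → Set α}

theorem mono (h : GenericallyFinite 𝒞) (hsub : ∀ Y, 𝒟 Y ⊆ 𝒞 Y) : GenericallyFinite 𝒟 := by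
  obtain ⟨F, hF, h⟩ := h
  exact ⟨F, hF, fun Y hY => (h Y hY).subset (hsub Y)⟩

theorem of_finite {s : Set α} (hs : s.Finite) :
    GenericallyFinite fun _ : ι → Fin 4 → ℂ => s :=
  ⟨1, one_ne_zero, fun _ _ => hs⟩

theorem iUnion {κ : Type} [Finite κ] {𝒞 : κ → (ι → Fin 4 → ℂ) → Set α}
    (h : ∀ k, GenericallyFinite (𝒞 k)) : GenericallyFinite fun Y => ⋃ k, 𝒞 k Y := by
  classical
  have := Fintype.ofFinite κ
  choose F hF h using h
  refine ⟨∏ k, F k, Finset.prod_ne_zero_iff.mpr fun k _ => hF k, fun Y hY => ?_⟩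
  rw [map_prod, Finset.prod_ne_zero_iff] at hY
  exact Set.finite_iUnion fun k => h k Y (hY k (Finset.mem_univ k))

theorem union (h : GenericallyFinite 𝒞) (h' : GenericallyFinite 𝒟) :
    GenericallyFinite fun Y => 𝒞 Y ∪ 𝒟 Y := by
  obtain ⟨F, hF, h⟩ := h
  obtain ⟨G, hG, h'⟩ := h'
  refine ⟨F * G, mul_ne_zero hF hG, fun Y hY => ?_⟩
  rw [map_mul, mul_ne_zero_iff] at hY
  exact (h Y hY.1).union (h' Y hY.2)

end GenericallyFinite

/-- Each `i ∈ T` contributes four equations and the three private unknowns `u, v, a`. The surplus of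
one equation per index pays for the parameters `t`, as `card δ + 3 |T| ≤ 4 |T|`. -/
theorem genericallyFinite_parameters {ι δ : Type} [Fintype ι] [Fintype δ] (x : ι → Fin 4 → ℂ)
    (T : Finset ι) (hT : Fintype.card δ ≤ T.card)
    (p : ι → (δ → ℂ) → ℂ → ℂ → Fin 4 → ℂ)
    (hp : ∀ i, IsPolyMap fun s : (δ ⊕ Fin 2) → ℂ =>
      p i (fun j => s (.inl j)) (s (.inr 0)) (s (.inr 1))) :
    GenericallyFinite fun Y : ι → Fin 4 → ℂ =>
      {t : δ → ℂ | ∀ i ∈ T, ∃ u v a : ℂ, Y i = p i t u v + a • x i} := by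
  classical
  have hq : ∀ k : T × Fin 4, IsPolyFun fun s : (δ ⊕ (T × Fin 3)) → ℂ =>
      (p k.1 (fun j => s (.inl j)) (s (.inr (k.1, 0))) (s (.inr (k.1, 1))) +
        s (.inr (k.1, 2)) • x k.1) k.2 := by
    intro k
    have h1 := (hp k.1).reindex (ρ := δ ⊕ (T × Fin 3))
      (Sum.elim Sum.inl fun j : Fin 2 => Sum.inr (k.1, j.castSucc))
    exact (h1.add ((IsPolyMap.const (x k.1)).smul (IsPolyFun.coord (Sum.inr (k.1, 2))))) k.2
  choose f hf using hq
  obtain ⟨F, hF, hfin⟩ := exists_polynomial_finite_fibre (σ := δ ⊕ (T × Fin 3))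
    (τ := T × Fin 4) (by
      simp only [Fintype.card_sum, Fintype.card_prod, Fintype.card_coe, Fintype.card_fin]
      omega) f
  refine ⟨MvPolynomial.rename (fun k : T × Fin 4 => ((k.1 : ι), k.2)) F, ?_, fun Y hY => ?_⟩
  · have hinj : Function.Injective (fun k : T × Fin 4 => ((k.1 : ι), k.2)) := by
      rintro ⟨a, b⟩ ⟨c, d⟩ h
      simp only [Prod.mk.injEq] at h
      exact Prod.ext (Subtype.ext h.1) h.2
    exact fun h => hF (MvPolynomial.rename_injective _ hinj (h.trans (map_zero _).symm))
  · rw [MvPolynomial.eval_rename] at hY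
    refine ((hfin _ hY).image fun s j => s (Sum.inl j)).subset ?_
    intro t ht
    choose! u v a h using ht
    refine ⟨Sum.elim t fun k => ![u k.1, v k.1, a k.1] k.2, fun k => ?_, by funext j; rfl⟩
    rw [hf]
    have := congrFun (h k.1 k.1.2) k.2
    simp only [Function.comp, this]
    rfl

/-! ### Families of curves meeting lines -/

/-- The indices of the points that do not lie on `β`. -/
noncomputable def missed {ι : Type} [Fintype ι] (P : ι → P3) (β : Set P3) : Finset ι := by
  classical exact Finset.univ.filter fun i => P i ∉ β

theorem mem_missed {ι : Type} [Fintype ι] {P : ι → P3} {β : Set P3} {i : ι} :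
    i ∈ missed P β ↔ P i ∉ β := by
  simp [missed]

/-- For every `P i` outside of `β`, the vector `Y i` represents a point on a line through `P i`
and a point of `β`. -/
def MeetsLines {ι : Type} (P : ι → P3) (Y : ι → Fin 4 → ℂ) (β : Set P3) : Prop :=
  ∀ i, P i ∉ β → ∃ (a : ℂ) (z : Fin 4 → ℂ) (hz : z ≠ 0),
    Projectivization.mk ℂ z hz ∈ β ∧ Y i = z + a • (P i).rep

/-- A family of curves with `d` parameters, each of which is the union of finitely many pieces
`(u, v) ↦ p k t u v`, has generically only finitely many members that meet the given lines,
provided that the members miss at least `d` of the points `P i`. -/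
theorem genericallyFinite_curves {ι δ κ : Type} [Fintype ι] [Fintype δ] [Finite κ] (P : ι → P3)
    (p : κ → (δ → ℂ) → ℂ → ℂ → Fin 4 → ℂ)
    (hp : ∀ k, IsPolyMap fun s : (δ ⊕ Fin 2) → ℂ =>
      p k (fun j => s (.inl j)) (s (.inr 0)) (s (.inr 1)))
    (B : (δ → ℂ) → Set P3) :
    GenericallyFinite fun Y : ι → Fin 4 → ℂ =>
      {β : Set P3 | Fintype.card δ ≤ (missed P β).card ∧ MeetsLines P Y β ∧ ∃ t, β = B t ∧
        ∀ z hz, Projectivization.mk ℂ z hz ∈ β → ∃ k u v, z = p k t u v} := by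
  classical
  -- `T` will be the set of missed indices, and `c i` the piece of the curve on which the `i`-th
  -- line is met; there are finitely many choices of both.
  have key : ∀ (T : {T : Finset ι // Fintype.card δ ≤ T.card}) (c : ι → κ),
      GenericallyFinite fun Y : ι → Fin 4 → ℂ =>
        B '' {t : δ → ℂ | ∀ i ∈ T.1, ∃ u v a : ℂ, Y i = p (c i) t u v + a • (P i).rep} := by
    intro T c
    obtain ⟨F, hF, h⟩ := genericallyFinite_parameters (fun i => (P i).rep) T.1 T.2
      (fun i => p (c i)) (fun i => hp (c i))
    exact ⟨F, hF, fun Y hY => (h Y hY).image B⟩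
  refine (GenericallyFinite.iUnion fun T => GenericallyFinite.iUnion fun c => key T c).mono ?_
  rintro Y β ⟨hcard, hmeet, t, rfl, ht⟩
  have hc : ∀ i, ∃ k : κ, P i ∉ B t →
      ∃ u v a : ℂ, Y i = p k t u v + a • (P i).rep := by
    intro i
    by_cases hi : P i ∈ B t
    -- Here `c i` is an irrelevant default; the point `P i` of the curve shows that `κ` is nonempty.
    · obtain ⟨k, -⟩ : ∃ k : κ, True := by
        have h := (P i).rep_nonzero
        obtain ⟨k, -⟩ := ht (P i).rep h (by rwa [Projectivization.mk_rep])
        exact ⟨k, trivial⟩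
      exact ⟨k, fun h => absurd hi h⟩
    · obtain ⟨a, z, hz, hzB, hY⟩ := hmeet i hi
      obtain ⟨k, u, v, rfl⟩ := ht z hz hzB
      exact ⟨k, fun _ => ⟨u, v, a, hY⟩⟩
  choose c hc using hc
  refine Set.mem_iUnion.mpr ⟨⟨missed P (B t), hcard⟩, Set.mem_iUnion.mpr ⟨c, t, ?_, rfl⟩⟩
  exact fun i hi => hc i (mem_missed.mp hi)

/-! ### Conics, lines and planes in coordinates -/

/-- The zero locus of `Q` in the plane with equation `h`. -/
def conicOf (h : Fin 4 → ℂ) (Q : QuadraticForm ℂ (Fin 4 → ℂ)) : Set P3 :=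
  {p : P3 | ∀ v ∈ p.submodule, h ⬝ᵥ v = 0 ∧ Q v = 0}

theorem mk_mem_conicOf {h : Fin 4 → ℂ} {Q : QuadraticForm ℂ (Fin 4 → ℂ)} {z : Fin 4 → ℂ}
    (hz : z ≠ 0) : Projectivization.mk ℂ z hz ∈ conicOf h Q ↔ h ⬝ᵥ z = 0 ∧ Q z = 0 := by
  simp only [conicOf, Set.mem_ofPred_eq, Projectivization.submodule_mk]
  constructor
  · intro H
    exact H z (Submodule.mem_span_singleton_self z)
  · rintro ⟨h1, h2⟩ v hv
    obtain ⟨a, rfl⟩ := Submodule.mem_span_singleton.mp hv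
    simp [h1, h2, QuadraticMap.map_smul]

theorem mem_conicOf {h : Fin 4 → ℂ} {Q : QuadraticForm ℂ (Fin 4 → ℂ)} {p : P3} :
    p ∈ conicOf h Q ↔ h ⬝ᵥ p.rep = 0 ∧ Q p.rep = 0 := by
  rw [← mk_mem_conicOf p.rep_nonzero, Projectivization.mk_rep]

theorem mk_mem_pointsOf {L : Submodule ℂ (Fin 4 → ℂ)} {z : Fin 4 → ℂ} (hz : z ≠ 0) :
    Projectivization.mk ℂ z hz ∈ pointsOf L ↔ z ∈ L := by
  simp [pointsOf, Projectivization.submodule_mk]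

theorem mem_pointsOf {L : Submodule ℂ (Fin 4 → ℂ)} {p : P3} :
    p ∈ pointsOf L ↔ p.rep ∈ L := by
  rw [← mk_mem_pointsOf p.rep_nonzero, Projectivization.mk_rep]

theorem linearIndependent_rep {p q : P3} (hpq : p ≠ q) :
    LinearIndependent ℂ ![p.rep, q.rep] := by
  have := (Projectivization.independent_pair_iff_ne p q).mpr hpq
  rw [Projectivization.independent_iff] at this
  rwa [show Projectivization.rep ∘ ![p, q] = ![p.rep, q.rep] by
    funext i; fin_cases i <;> rfl] at this

theorem linearIndependent_triple_iff {V : Type*} [AddCommGroup V] [Module ℂ V] {x y z : V} :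
    LinearIndependent ℂ ![x, y, z] ↔
      ∀ a b c : ℂ, a • x + b • y + c • z = 0 → a = 0 ∧ b = 0 ∧ c = 0 := by
  rw [Fintype.linearIndependent_iff]
  constructor
  · intro H a b c h
    have := H ![a, b, c] (by simpa [Fin.sum_univ_three] using h)
    exact ⟨this 0, this 1, this 2⟩
  · intro H g hg
    have := H (g 0) (g 1) (g 2) (by simpa [Fin.sum_univ_three] using hg)
    intro i
    fin_cases i
    exacts [this.1, this.2.1, this.2.2]

theorem quadratic_pair {V : Type*} [AddCommGroup V] [Module ℂ V] (Q : QuadraticForm ℂ V)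
    (x y : V) (a b : ℂ) :
    Q (a • x + b • y) = a ^ 2 * Q x + b ^ 2 * Q y + a * b * QuadraticMap.polar Q x y := by
  rw [QuadraticMap.map_add Q, QuadraticMap.map_smul, QuadraticMap.map_smul,
    QuadraticMap.polar_smul_left, QuadraticMap.polar_smul_right]
  simp only [smul_eq_mul]
  ring

theorem quadratic_triple {V : Type*} [AddCommGroup V] [Module ℂ V] (Q : QuadraticForm ℂ V)
    (x y z : V) (a b c : ℂ) :
    Q (a • x + b • y + c • z) = a ^ 2 * Q x + b ^ 2 * Q y + c ^ 2 * Q z +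
      a * b * QuadraticMap.polar Q x y + a * c * QuadraticMap.polar Q x z +
      b * c * QuadraticMap.polar Q y z := by
  rw [QuadraticMap.map_add Q, quadratic_pair, QuadraticMap.map_smul,
    QuadraticMap.polar_add_left, QuadraticMap.polar_smul_right, QuadraticMap.polar_smul_left,
    QuadraticMap.polar_smul_right, QuadraticMap.polar_smul_left]
  simp only [smul_eq_mul]
  ring

theorem exists_zero_binary_form (a b c : ℂ) :
    ∃ u v : ℂ, (u ≠ 0 ∨ v ≠ 0) ∧ a * u ^ 2 + b * (u * v) + c * v ^ 2 = 0 := by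
  by_cases ha : a = 0
  · exact ⟨1, 0, Or.inl one_ne_zero, by simp [ha]⟩
  · obtain ⟨s, hs⟩ := IsAlgClosed.exists_pow_nat_eq (discrim a b c) (n := 2) (by norm_num)
    obtain ⟨x, hx⟩ := exists_quadratic_eq_zero ha ⟨s, by rw [← hs]; ring⟩
    exact ⟨x, 1, Or.inr one_ne_zero, by linear_combination hx⟩

/-- The plane `h ⬝ᵥ v = 0`. -/
noncomputable def planeOf (h : Fin 4 → ℂ) : Submodule ℂ (Fin 4 → ℂ) :=
  LinearMap.ker (dotProductBilin ℂ ℂ h)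

theorem mem_planeOf {h v : Fin 4 → ℂ} : v ∈ planeOf h ↔ h ⬝ᵥ v = 0 := by
  simp [planeOf]

theorem finrank_planeOf {h : Fin 4 → ℂ} (hh : h ≠ 0) : Module.finrank ℂ (planeOf h) = 3 := by
  have h1 : Module.finrank ℂ (planeOf h) < 4 := by
    have : planeOf h ≠ ⊤ := by
      intro htop
      apply hh
      funext i
      have : Pi.single i (1 : ℂ) ∈ planeOf h := by rw [htop]; trivial
      simpa [mem_planeOf] using this
    have := Submodule.finrank_lt this
    simpa using this
  have h2 := LinearMap.finrank_range_add_finrank_ker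
    (dotProductBilin ℂ ℂ h : (Fin 4 → ℂ) →ₗ[ℂ] ℂ)
  have h3 := Submodule.finrank_le (LinearMap.range
    (dotProductBilin ℂ ℂ h : (Fin 4 → ℂ) →ₗ[ℂ] ℂ))
  simp only [Module.finrank_fintype_fun_eq_card, Fintype.card_fin, Module.finrank_self] at h2 h3
  change _ + Module.finrank ℂ (planeOf h) = 4 at h2
  omega

theorem span_triple_eq {H : Submodule ℂ (Fin 4 → ℂ)} (hH : Module.finrank ℂ H = 3)
    {x y z : Fin 4 → ℂ} (hx : x ∈ H) (hy : y ∈ H) (hz : z ∈ H)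
    (hind : LinearIndependent ℂ ![x, y, z]) : Submodule.span ℂ {x, y, z} = H := by
  refine Submodule.eq_of_le_of_finrank_le ?_ ?_
  · rw [Submodule.span_le]
    rintro v (rfl | rfl | rfl) <;> assumption
  · have := finrank_span_eq_card hind
    rw [show Set.range ![x, y, z] = {x, y, z} by
      ext; simp [Matrix.range_cons, or_comm, or_left_comm, eq_comm]] at this
    rw [this, hH]
    simp

theorem exists_coordinates_of_mem_planeOf {h : Fin 4 → ℂ} (hh : h ≠ 0)
    {x y z v : Fin 4 → ℂ} (hx : h ⬝ᵥ x = 0) (hy : h ⬝ᵥ y = 0) (hz : h ⬝ᵥ z = 0)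
    (hind : LinearIndependent ℂ ![x, y, z]) (hv : h ⬝ᵥ v = 0) :
    ∃ a b c : ℂ, a • x + b • y + c • z = v := by
  have := span_triple_eq (finrank_planeOf hh) (mem_planeOf.mpr hx) (mem_planeOf.mpr hy)
    (mem_planeOf.mpr hz) hind
  rw [← mem_planeOf, ← this, Submodule.mem_span_triple] at hv
  exact hv

theorem span_pair_eq {E : Submodule ℂ (Fin 4 → ℂ)} (hE : Module.finrank ℂ E = 2)
    {x y : Fin 4 → ℂ} (hx : x ∈ E) (hy : y ∈ E)
    (hind : LinearIndependent ℂ ![x, y]) : Submodule.span ℂ {x, y} = E := by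
  refine Submodule.eq_of_le_of_finrank_le ?_ ?_
  · rw [Submodule.span_le]
    rintro v (rfl | rfl) <;> assumption
  · have := finrank_span_eq_card hind
    rw [show Set.range ![x, y] = {x, y} by
      ext; simp [Matrix.range_cons, or_comm, eq_comm]] at this
    rw [this, hE]
    simp

theorem finrank_span_pair {x y : Fin 4 → ℂ}
    (hind : LinearIndependent ℂ ![x, y]) : Module.finrank ℂ (Submodule.span ℂ {x, y}) = 2 := by
  have := finrank_span_eq_card hind
  rw [show Set.range ![x, y] = {x, y} by
    ext; simp [Matrix.range_cons, or_comm, eq_comm]] at this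
  rw [this]
  simp

/-! ### Normal form of a conic without lines -/

/-- The conic `w (u + c v) + q₁ u² + q₂ u v + q₃ v² = 0` in the plane with coordinate vectors
`e₀, e₁, e₂` and coordinates `w, u, v`. -/
def planeConic (e₀ e₁ e₂ : Fin 4 → ℂ) (c q₁ q₂ q₃ : ℂ) : Set P3 :=
  {P | ∃ w u v : ℂ, P.rep = w • e₀ + u • e₁ + v • e₂ ∧
    w * (u + c * v) + q₁ * u ^ 2 + q₂ * (u * v) + q₃ * v ^ 2 = 0}

/-- The rational parametrization of `planeConic` by projection from `e₀`. -/
def planeConicPoint (e₀ e₁ e₂ : Fin 4 → ℂ) (c q₁ q₂ q₃ u v : ℂ) : Fin 4 → ℂ :=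
  (u + c * v) • (u • e₁ + v • e₂) + (-1 * (q₁ * (u * u) + q₂ * (u * v) + q₃ * (v * v))) • e₀

/-- Any two independent isotropic vectors in the plane `h` have nonzero pairing: the conic contains
no line. -/
def ContainsNoLine (h : Fin 4 → ℂ) (Q : QuadraticForm ℂ (Fin 4 → ℂ)) : Prop :=
  ∀ x y : Fin 4 → ℂ, h ⬝ᵥ x = 0 → Q x = 0 → h ⬝ᵥ y = 0 → Q y = 0 →
    LinearIndependent ℂ ![x, y] → QuadraticMap.polar Q x y ≠ 0

namespace ContainsNoLine
variable {h : Fin 4 → ℂ} {Q : QuadraticForm ℂ (Fin 4 → ℂ)}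

/-- On the span of `x` and `y` the form is `a b` times a nonzero constant, so its only zeros are
multiples of `x` or of `y`. -/
theorem linearIndependent_triple (hQ : ContainsNoLine h Q) {x y z : Fin 4 → ℂ}
    (hx : h ⬝ᵥ x = 0) (qx : Q x = 0) (hy : h ⬝ᵥ y = 0) (qy : Q y = 0) (qz : Q z = 0)
    (hxy : LinearIndependent ℂ ![x, y]) (hxz : LinearIndependent ℂ ![x, z])
    (hyz : LinearIndependent ℂ ![y, z]) : LinearIndependent ℂ ![x, y, z] := by
  rw [LinearIndependent.pair_iff] at hxz hyz
  rw [linearIndependent_triple_iff]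
  intro a b c habc
  have h1 : Q (a • x + b • y) = 0 := by
    rw [show a • x + b • y = (-c) • z by
      rw [neg_smul]; exact eq_neg_of_add_eq_zero_left habc]
    simp [QuadraticMap.map_smul, qz]
  rw [quadratic_pair, qx, qy] at h1
  have h2 : a * b = 0 := by
    simpa [hQ x y hx qx hy qy hxy] using h1
  rcases mul_eq_zero.mp h2 with rfl | rfl
  · obtain ⟨rfl, rfl⟩ := hyz b c (by simpa using habc)
    simp
  · obtain ⟨rfl, rfl⟩ := hxz a c (by simpa using habc)
    simp

/-- Otherwise `e₀` is a singular point, and its join with a zero of `Q` on the line through `e₁` and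
`e₂` lies in the conic. -/
theorem polar_ne_zero_or (hQ : ContainsNoLine h Q) {e₀ e₁ e₂ : Fin 4 → ℂ}
    (h0 : h ⬝ᵥ e₀ = 0) (q0 : Q e₀ = 0) (h1 : h ⬝ᵥ e₁ = 0) (h2 : h ⬝ᵥ e₂ = 0)
    (hind : LinearIndependent ℂ ![e₀, e₁, e₂]) :
    QuadraticMap.polar Q e₀ e₁ ≠ 0 ∨ QuadraticMap.polar Q e₀ e₂ ≠ 0 := by
  by_contra! hcon
  obtain ⟨u, v, huv, hz⟩ := exists_zero_binary_form (Q e₁) (QuadraticMap.polar Q e₁ e₂) (Q e₂)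
  refine hQ e₀ (u • e₁ + v • e₂) h0 q0 (by simp [h1, h2]) ?_ ?_ ?_
  · rw [quadratic_pair]
    linear_combination hz
  · rw [linearIndependent_triple_iff] at hind
    rw [LinearIndependent.pair_iff]
    intro s t hst
    obtain ⟨hs, ht1, ht2⟩ := hind s (t * u) (t * v) (by
      rw [← hst]; module)
    refine ⟨hs, ?_⟩
    rcases huv with hu | hv
    · exact (mul_eq_zero.mp ht1).resolve_right hu
    · exact (mul_eq_zero.mp ht2).resolve_right hv
  · simp [QuadraticMap.polar_add_right, QuadraticMap.polar_smul_right, hcon.1, hcon.2]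

/-- Dividing by the polar value makes the coefficient of `w u` equal to one. Since `planeConicPoint`
is quadratic in `u, v`, reaching the vector `z` itself, and not only its class, requires square
roots. -/
theorem normal_form (hQ : ContainsNoLine h Q) (hh : h ≠ 0) {e₀ e₁ e₂ : Fin 4 → ℂ}
    (h0 : h ⬝ᵥ e₀ = 0) (q0 : Q e₀ = 0) (h1 : h ⬝ᵥ e₁ = 0) (h2 : h ⬝ᵥ e₂ = 0)
    (hind : LinearIndependent ℂ ![e₀, e₁, e₂]) (hp : QuadraticMap.polar Q e₀ e₁ ≠ 0) :
    ∃ c q₁ q₂ q₃ : ℂ, q₁ = Q e₁ / QuadraticMap.polar Q e₀ e₁ ∧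
      q₃ = Q e₂ / QuadraticMap.polar Q e₀ e₁ ∧
      conicOf h Q = planeConic e₀ e₁ e₂ c q₁ q₂ q₃ ∧
      ∀ z hz, Projectivization.mk ℂ z hz ∈ conicOf h Q →
        ∃ u v, z = planeConicPoint e₀ e₁ e₂ c q₁ q₂ q₃ u v := by
  set l := QuadraticMap.polar Q e₀ e₁ with hl
  set c := QuadraticMap.polar Q e₀ e₂ / l with hc
  set q₁ := Q e₁ / l with hq₁
  set q₂ := QuadraticMap.polar Q e₁ e₂ / l with hq₂
  set q₃ := Q e₂ / l with hq₃
  have hval : ∀ w u v : ℂ, Q (w • e₀ + u • e₁ + v • e₂) =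
      l * (w * (u + c * v) + q₁ * u ^ 2 + q₂ * (u * v) + q₃ * v ^ 2) := by
    intro w u v
    rw [quadratic_triple, q0, ← hl, hc, hq₁, hq₂, hq₃]
    field_simp
    ring
  have hplane : ∀ w u v : ℂ, h ⬝ᵥ (w • e₀ + u • e₁ + v • e₂) = 0 := by
    intro w u v
    simp [h0, h1, h2]
  refine ⟨c, q₁, q₂, q₃, rfl, rfl, ?_, ?_⟩
  · ext P
    rw [mem_conicOf]
    constructor
    · rintro ⟨hP, qP⟩
      obtain ⟨w, u, v, hwuv⟩ := exists_coordinates_of_mem_planeOf hh h0 h1 h2 hind hP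
      refine ⟨w, u, v, hwuv.symm, ?_⟩
      rw [← hwuv, hval] at qP
      exact (mul_eq_zero.mp qP).resolve_left hp
    · rintro ⟨w, u, v, hrep, heq⟩
      rw [hrep, hval, heq, mul_zero]
      exact ⟨hplane w u v, rfl⟩
  · intro z hz hmem
    rw [mk_mem_conicOf] at hmem
    obtain ⟨w, u, v, rfl⟩ := exists_coordinates_of_mem_planeOf hh h0 h1 h2 hind hmem.1
    have heq := (mul_eq_zero.mp ((hval w u v).symm.trans hmem.2)).resolve_left hp
    -- `u + c v = 0` is the tangent line at `e₀`; a further zero on it would put the whole tangent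
    -- into the conic.
    have hline : ∀ u v : ℂ, (u ≠ 0 ∨ v ≠ 0) → u + c * v = 0 →
        q₁ * u ^ 2 + q₂ * (u * v) + q₃ * v ^ 2 ≠ 0 := by
      intro u v huv hL hq
      refine hQ e₀ (u • e₁ + v • e₂) h0 q0 (by simpa using hplane 0 u v) ?_ ?_ ?_
      · have := hval 0 u v
        rw [zero_smul, zero_add] at this
        rw [this]
        linear_combination l * hq
      · rw [linearIndependent_triple_iff] at hind
        rw [LinearIndependent.pair_iff]
        intro s t hst
        obtain ⟨hs, ht1, ht2⟩ := hind s (t * u) (t * v) (by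
          rw [← hst]; module)
        refine ⟨hs, ?_⟩
        rcases huv with hu | hv
        · exact (mul_eq_zero.mp ht1).resolve_right hu
        · exact (mul_eq_zero.mp ht2).resolve_right hv
      · rw [QuadraticMap.polar_add_right, QuadraticMap.polar_smul_right,
          QuadraticMap.polar_smul_right, ← hl]
        have : QuadraticMap.polar Q e₀ e₂ = l * c := by rw [hc]; field_simp
        rw [this, smul_eq_mul, smul_eq_mul]
        linear_combination l * hL
    by_cases hL : u + c * v = 0
    · have huv : u = 0 ∧ v = 0 := by
        by_contra hne
        refine hline u v ?_ hL ?_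
        · by_contra! hcon
          exact hne hcon
        · linear_combination heq - w * hL
      obtain ⟨rfl, rfl⟩ := huv
      -- The point is `e₀`, which the parametrization attains in the tangent direction `(-c, 1)`.
      set q := q₁ * (-c) ^ 2 + q₂ * ((-c) * 1) + q₃ * 1 ^ 2 with hq
      have hq0 : q ≠ 0 := hline (-c) 1 (Or.inr one_ne_zero) (by ring)
      obtain ⟨μ, hμ⟩ := IsAlgClosed.exists_pow_nat_eq (-w / q) (n := 2) (by norm_num)
      refine ⟨-c * μ, μ, ?_⟩
      have h3 : (-1 * (q₁ * (-c * μ * (-c * μ)) + q₂ * (-c * μ * μ) + q₃ * (μ * μ))) = w := by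
        have : μ ^ 2 * q = -w := by rw [hμ]; field_simp
        rw [hq] at this
        linear_combination -this
      rw [planeConicPoint, h3, show -c * μ + c * μ = 0 by ring]
      simp
    · obtain ⟨μ, hμ⟩ := IsAlgClosed.exists_pow_nat_eq (1 / (u + c * v)) (n := 2) (by norm_num)
      refine ⟨μ * u, μ * v, ?_⟩
      have hμ' : μ ^ 2 * (u + c * v) = 1 := by rw [hμ]; field_simp
      have h3 : (-1 * (q₁ * (μ * u * (μ * u)) + q₂ * (μ * u * (μ * v)) +
          q₃ * (μ * v * (μ * v)))) = w := by
        linear_combination w * hμ' - μ ^ 2 * heq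
      rw [planeConicPoint, h3]
      have h4 : (μ * u + c * (μ * v)) • ((μ * u) • e₁ + (μ * v) • e₂) =
          (μ ^ 2 * (u + c * v)) • (u • e₁ + v • e₂) := by module
      rw [h4, hμ', one_smul]
      abel

end ContainsNoLine

theorem IsPolyMap.planeConicPoint {σ : Type} {e₀ e₁ e₂ : (σ → ℂ) → Fin 4 → ℂ}
    {c q₁ q₂ q₃ u v : (σ → ℂ) → ℂ} (h0 : IsPolyMap e₀) (h1 : IsPolyMap e₁) (h2 : IsPolyMap e₂)
    (hc : IsPolyFun c) (hq₁ : IsPolyFun q₁) (hq₂ : IsPolyFun q₂) (hq₃ : IsPolyFun q₃)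
    (hu : IsPolyFun u) (hv : IsPolyFun v) :
    IsPolyMap fun x => planeConicPoint (e₀ x) (e₁ x) (e₂ x) (c x) (q₁ x) (q₂ x) (q₃ x)
      (u x) (v x) :=
  (((h1.smul hu).add (h2.smul hv)).smul (hu.add (hc.mul hv))).add
    (h0.smul ((IsPolyFun.const (-1)).mul
      (((hq₁.mul (hu.mul hu)).add (hq₂.mul (hu.mul hv))).add (hq₃.mul (hv.mul hv)))))

/-! ### Conics without lines: charts and parameter counts -/

theorem exists_two_others (j k : Fin 4) (hjk : j ≠ k) :
    ∃ l m : Fin 4, l ≠ m ∧ l ≠ j ∧ l ≠ k ∧ m ≠ j ∧ m ≠ k := by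
  revert j k
  decide

/-- Charts with two parameters for the planes through a point. With `h k ≠ 0` the plane is a graph
over the other three coordinates; `x` has a nonzero coordinate `j` among these, and the two
remaining ones complete the basis. -/
theorem exists_plane_basis {h x : Fin 4 → ℂ} (hh : h ≠ 0) (hx : x ≠ 0) (hhx : h ⬝ᵥ x = 0) :
    ∃ (k l m : Fin 4) (s t : ℂ),
      h ⬝ᵥ (Pi.single l (1 : ℂ) + s • Pi.single k (1 : ℂ)) = 0 ∧
      h ⬝ᵥ (Pi.single m (1 : ℂ) + t • Pi.single k (1 : ℂ)) = 0 ∧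
      LinearIndependent ℂ ![x, Pi.single l (1 : ℂ) + s • Pi.single k (1 : ℂ),
        Pi.single m (1 : ℂ) + t • Pi.single k (1 : ℂ)] := by
  obtain ⟨k, hk⟩ := Function.ne_iff.mp hh
  obtain ⟨j, hjk, hj⟩ : ∃ j, j ≠ k ∧ x j ≠ 0 := by
    by_contra! hcon
    apply hx
    have hxk : x = Pi.single k (x k) := by
      funext j
      by_cases hjk : j = k
      · subst hjk; simp
      · simp [hcon j hjk, hjk]
    rw [hxk] at hhx ⊢
    have : h k * x k = 0 := by simpa using hhx
    rw [(mul_eq_zero.mp this).resolve_left hk, Pi.single_zero]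
  obtain ⟨l, m, hlm, hlj, hlk, hmj, hmk⟩ := exists_two_others j k hjk
  have hk' : h k ≠ 0 := hk
  refine ⟨k, l, m, -(h l / h k), -(h m / h k), ?_, ?_, ?_⟩
  · simp only [dotProduct_add, dotProduct_smul, dotProduct_single, mul_one, smul_eq_mul]
    field_simp
    ring
  · simp only [dotProduct_add, dotProduct_smul, dotProduct_single, mul_one, smul_eq_mul]
    field_simp
    ring
  · rw [linearIndependent_triple_iff]
    intro a b c habc
    have ha : a = 0 := by
      have := congrFun habc j
      simp [hlj.symm, hmj.symm, hjk] at this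
      exact this.resolve_right hj
    subst ha
    have hl := congrFun habc l
    have hm := congrFun habc m
    simp [hlm, hlk] at hl
    simp [hlm.symm, hmk] at hm
    exact ⟨rfl, hl, hm⟩

section

variable (O : P3) (P : Fin 6 → P3)

/-- The line-free conics through `O` that meet the given lines. -/
def lineFreeConics (Y : Fin 6 → Fin 4 → ℂ) : Set (Set P3) :=
  {β | (∃ h Q, h ≠ 0 ∧ ContainsNoLine h Q ∧ β = conicOf h Q) ∧ O ∈ β ∧ MeetsLines P Y β}

/-- Two parameters for the plane through `O`, four for a conic through `O` in it. -/
theorem genericallyFinite_lineFree_of_six :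
    GenericallyFinite fun Y => {β ∈ lineFreeConics O P Y | 6 ≤ (missed P β).card} := by
  have key := fun k l m : Fin 4 => genericallyFinite_curves (δ := Fin 6) (κ := Unit) P
    (fun _ t u v => planeConicPoint O.rep (Pi.single l (1 : ℂ) + t 0 • Pi.single k (1 : ℂ))
      (Pi.single m (1 : ℂ) + t 1 • Pi.single k (1 : ℂ)) (t 2) (t 3) (t 4) (t 5) u v)
    (fun _ => IsPolyMap.planeConicPoint (.const _)
      ((IsPolyMap.const _).add ((IsPolyMap.const _).smul (.coord _)))
      ((IsPolyMap.const _).add ((IsPolyMap.const _).smul (.coord _)))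
      (.coord _) (.coord _) (.coord _) (.coord _) (.coord _) (.coord _))
    (fun t => planeConic O.rep (Pi.single l (1 : ℂ) + t 0 • Pi.single k (1 : ℂ))
      (Pi.single m (1 : ℂ) + t 1 • Pi.single k (1 : ℂ)) (t 2) (t 3) (t 4) (t 5))
  refine (GenericallyFinite.iUnion fun k => GenericallyFinite.iUnion fun l =>
    GenericallyFinite.iUnion fun m => key k l m).mono ?_
  rintro Y β ⟨⟨⟨h, Q, hh, hQ, rfl⟩, hO, hmeet⟩, hcard⟩
  simp only [Set.mem_iUnion]
  have hO' := mem_conicOf.mp hO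
  obtain ⟨k, l, m, s, t, h1, h2, hind⟩ := exists_plane_basis hh O.rep_nonzero hO'.1
  rcases hQ.polar_ne_zero_or hO'.1 hO'.2 h1 h2 hind with hp | hp
  · obtain ⟨c, q₁, q₂, q₃, -, -, hβ, hz⟩ := hQ.normal_form hh hO'.1 hO'.2 h1 h2 hind hp
    exact ⟨k, l, m, by simpa using hcard, hmeet, ![s, t, c, q₁, q₂, q₃], hβ,
      fun z hz0 hzm => ⟨(), hz z hz0 hzm⟩⟩
  · have hind' : LinearIndependent ℂ ![O.rep, Pi.single m (1 : ℂ) + t • Pi.single k (1 : ℂ),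
        Pi.single l (1 : ℂ) + s • Pi.single k (1 : ℂ)] := by
      rw [linearIndependent_triple_iff] at hind ⊢
      intro a b c habc
      obtain ⟨ha, hc, hb⟩ := hind a c b (by rw [← habc]; abel)
      exact ⟨ha, hb, hc⟩
    obtain ⟨c, q₁, q₂, q₃, -, -, hβ, hz⟩ := hQ.normal_form hh hO'.1 hO'.2 h2 h1 hind' hp
    exact ⟨k, m, l, by simpa using hcard, hmeet, ![t, s, c, q₁, q₂, q₃], hβ,
      fun z hz0 hzm => ⟨(), hz z hz0 hzm⟩⟩

/-- The planes through a line form a pencil, covered by two charts with one parameter. -/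
theorem exists_plane_complement {x y : Fin 4 → ℂ} (hxy : LinearIndependent ℂ ![x, y]) :
    ∃ b : Bool → Fin 4 → ℂ, ∀ h : Fin 4 → ℂ, h ≠ 0 → h ⬝ᵥ x = 0 → h ⬝ᵥ y = 0 →
      ∃ (i : Bool) (s : ℂ), h ⬝ᵥ (b i + s • b (!i)) = 0 ∧
        LinearIndependent ℂ ![x, y, b i + s • b (!i)] := by
  obtain ⟨b₁, h₁⟩ := exists_linearIndependent_cons_of_lt_finrank hxy (by simp)
  obtain ⟨b₂, h₂⟩ := exists_linearIndependent_cons_of_lt_finrank h₁ (by simp)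
  replace h₂ : LinearIndependent ℂ ![b₂, b₁, x, y] := h₂
  have hbasis : ∀ a b c d : ℂ, a • x + b • y + c • b₁ + d • b₂ = 0 →
      a = 0 ∧ b = 0 ∧ c = 0 ∧ d = 0 := by
    intro a b c d habcd
    have := Fintype.linearIndependent_iff.mp h₂ ![d, c, a, b] (by
      simp only [Fin.sum_univ_four]
      rw [← habcd]
      change d • b₂ + c • b₁ + a • x + b • y = _
      abel)
    exact ⟨this 2, this 3, this 1, this 0⟩
  refine ⟨fun i => if i then b₁ else b₂, fun h hh hx hy => ?_⟩
  by_cases hb₂ : h ⬝ᵥ b₂ = 0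
  · have hb₁ : h ⬝ᵥ b₁ ≠ 0 := by
      intro hb₁
      apply hh
      have hspan : Submodule.span ℂ (Set.range ![b₂, b₁, x, y]) = ⊤ :=
        h₂.span_eq_top_of_card_eq_finrank (by simp)
      have hle : planeOf h = ⊤ := by
        rw [eq_top_iff, ← hspan, Submodule.span_le]
        rintro _ ⟨i, rfl⟩
        rw [SetLike.mem_coe, mem_planeOf]
        fin_cases i
        exacts [hb₂, hb₁, hx, hy]
      by_contra h0
      have := finrank_planeOf h0
      rw [hle, finrank_top, Module.finrank_fintype_fun_eq_card] at this
      simp at this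
    refine ⟨false, 0, by simpa using hb₂, ?_⟩
    rw [linearIndependent_triple_iff]
    intro a b c habc
    obtain ⟨ha, hb, -, hc⟩ := hbasis a b 0 c (by rw [← habc]; simp)
    exact ⟨ha, hb, hc⟩
  · refine ⟨true, -(h ⬝ᵥ b₁ / h ⬝ᵥ b₂), ?_, ?_⟩
    · simp only [dotProduct_add, dotProduct_smul, smul_eq_mul, Bool.not_true,
        Bool.false_eq_true, if_true, if_false]
      field_simp
      ring
    · rw [linearIndependent_triple_iff]
      intro a b c habc
      obtain ⟨ha, hb, hc, -⟩ := hbasis a b c (c * -(h ⬝ᵥ b₁ / h ⬝ᵥ b₂)) (by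
        rw [← habc]; simp only [if_true, Bool.not_true, Bool.false_eq_true, if_false]; module)
      exact ⟨ha, hb, hc⟩

variable (hO : ∀ i, O ≠ P i) (hP : Function.Injective P)
include hO

/-- One parameter for the plane in the pencil through `O` and `P i`, three for the conic: `P i` on
it forces `q₁ = 0`. -/
theorem genericallyFinite_lineFree_of_four :
    GenericallyFinite fun Y => {β ∈ lineFreeConics O P Y |
      4 ≤ (missed P β).card ∧ ∃ i, P i ∈ β} := by
  choose b hb using fun i => exists_plane_complement (linearIndependent_rep (hO i))
  have key := fun (i : Fin 6) (j : Bool) => genericallyFinite_curves (δ := Fin 4) (κ := Unit) P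
    (fun _ t u v => planeConicPoint O.rep (P i).rep (b i j + t 0 • b i (!j))
      (t 1) (0) (t 2) (t 3) u v)
    (fun _ => IsPolyMap.planeConicPoint (.const _) (.const _)
      ((IsPolyMap.const _).add ((IsPolyMap.const _).smul (.coord _)))
      (.coord _) (.const _) (.coord _) (.coord _) (.coord _) (.coord _))
    (fun t => planeConic O.rep (P i).rep (b i j + t 0 • b i (!j)) (t 1) 0 (t 2) (t 3))
  refine (GenericallyFinite.iUnion fun i => GenericallyFinite.iUnion fun j => key i j).mono ?_
  rintro Y β ⟨⟨⟨h, Q, hh, hQ, rfl⟩, hOβ, hmeet⟩, hcard, i, hi⟩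
  simp only [Set.mem_iUnion]
  have hO' := mem_conicOf.mp hOβ
  have hi' := mem_conicOf.mp hi
  obtain ⟨j, s, h2, hind⟩ := hb i h hh hO'.1 hi'.1
  obtain ⟨c, q₁, q₂, q₃, hq₁, -, hβ, hz⟩ := hQ.normal_form hh hO'.1 hO'.2 hi'.1 h2 hind
    (hQ _ _ hO'.1 hO'.2 hi'.1 hi'.2 (linearIndependent_rep (hO i)))
  rw [hi'.2, zero_div] at hq₁
  subst hq₁
  exact ⟨i, j, by simpa using hcard, hmeet, ![s, c, q₂, q₃], hβ,
    fun z hz0 hzm => ⟨(), hz z hz0 hzm⟩⟩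

include hP

theorem lineFree_normal_form {h : Fin 4 → ℂ} {Q : QuadraticForm ℂ (Fin 4 → ℂ)} (hh : h ≠ 0)
    (hQ : ContainsNoLine h Q) (hOβ : O ∈ conicOf h Q) {i j : Fin 6} (hij : i ≠ j)
    (hi : P i ∈ conicOf h Q) (hj : P j ∈ conicOf h Q) :
    LinearIndependent ℂ ![O.rep, (P i).rep, (P j).rep] ∧
    ∃ c q : ℂ, conicOf h Q = planeConic O.rep (P i).rep (P j).rep c 0 q 0 ∧
      ∀ z hz, Projectivization.mk ℂ z hz ∈ conicOf h Q →
        ∃ u v, z = planeConicPoint O.rep (P i).rep (P j).rep c 0 q 0 u v := by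
  have hO' := mem_conicOf.mp hOβ
  have hi' := mem_conicOf.mp hi
  have hj' := mem_conicOf.mp hj
  have hind := hQ.linearIndependent_triple hO'.1 hO'.2 hi'.1 hi'.2 hj'.2
    (linearIndependent_rep (hO i)) (linearIndependent_rep (hO j))
    (linearIndependent_rep (hP.ne hij))
  obtain ⟨c, q₁, q₂, q₃, hq₁, hq₃, hβ, hz⟩ := hQ.normal_form hh hO'.1 hO'.2 hi'.1 hj'.1 hind
    (hQ _ _ hO'.1 hO'.2 hi'.1 hi'.2 (linearIndependent_rep (hO i)))
  rw [hi'.2, zero_div] at hq₁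
  rw [hj'.2, zero_div] at hq₃
  subst hq₁ hq₃
  exact ⟨hind, c, q₂, hβ, hz⟩

/-- The three points are not collinear and fix the plane; the conics left are `w (u + c v) + q u v =
0`. -/
theorem genericallyFinite_lineFree_of_two :
    GenericallyFinite fun Y => {β ∈ lineFreeConics O P Y |
      2 ≤ (missed P β).card ∧ ∃ i j, i ≠ j ∧ P i ∈ β ∧ P j ∈ β} := by
  have key := fun (i j : Fin 6) => genericallyFinite_curves (δ := Fin 2) (κ := Unit) P
    (fun _ t u v => planeConicPoint O.rep (P i).rep (P j).rep (t 0) (0) (t 1) (0) u v)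
    (fun _ => IsPolyMap.planeConicPoint (.const _) (.const _) (.const _)
      (.coord _) (.const _) (.coord _) (.const _) (.coord _) (.coord _))
    (fun t => planeConic O.rep (P i).rep (P j).rep (t 0) 0 (t 1) 0)
  refine (GenericallyFinite.iUnion fun i => GenericallyFinite.iUnion fun j => key i j).mono ?_
  rintro Y β ⟨⟨⟨h, Q, hh, hQ, rfl⟩, hOβ, hmeet⟩, hcard, i, j, hij, hi, hj⟩
  simp only [Set.mem_iUnion]
  obtain ⟨-, c, q, hβ, hz⟩ := lineFree_normal_form O P hO hP hh hQ hOβ hij hi hj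
  exact ⟨i, j, by simpa using hcard, hmeet, ![c, q], hβ,
    fun z hz0 hzm => ⟨(), hz z hz0 hzm⟩⟩

/-- There is at most one line-free conic through five given points. -/
theorem subsingleton_lineFree {i j k l : Fin 6} (hij : i ≠ j) (hik : i ≠ k)
    (hil : i ≠ l) (hjk : j ≠ k) (hjl : j ≠ l) (hkl : k ≠ l) :
    {β : Set P3 | (∃ h Q, h ≠ 0 ∧ ContainsNoLine h Q ∧ β = conicOf h Q) ∧ O ∈ β ∧
      P i ∈ β ∧ P j ∈ β ∧ P k ∈ β ∧ P l ∈ β}.Subsingleton := by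
  rintro _ ⟨⟨h, Q, hh, hQ, rfl⟩, hOβ, hi, hj, hk, hl⟩ _ ⟨⟨h', Q', hh', hQ', rfl⟩, hOβ', hi', hj',
    hk', hl'⟩
  obtain ⟨hind, c, q, hβ, -⟩ := lineFree_normal_form O P hO hP hh hQ hOβ hij hi hj
  obtain ⟨-, c', q', hβ', -⟩ := lineFree_normal_form O P hO hP hh' hQ' hOβ' hij hi' hj'
  have hiO := mem_conicOf.mp hi
  have hOO := mem_conicOf.mp hOβ
  -- The difference of the two equations is `v (w (c - c') + u (q - q')) = 0`, and `v ≠ 0` because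
  -- `P m` is off the line through `O` and `P i`.
  have hoff : ∀ m, i ≠ m → P m ∈ conicOf h Q → P m ∈ conicOf h' Q' →
      ∃ w u v : ℂ, v ≠ 0 ∧ (P m).rep = w • O.rep + u • (P i).rep + v • (P j).rep ∧
        w * (c - c') + u * (q - q') = 0 := by
    intro m him hm hm'
    have hmO := mem_conicOf.mp hm
    have hind3 := hQ.linearIndependent_triple hOO.1 hOO.2 hiO.1 hiO.2 hmO.2
      (linearIndependent_rep (hO i)) (linearIndependent_rep (hO m))
      (linearIndependent_rep (hP.ne him))
    rw [linearIndependent_triple_iff] at hind hind3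
    rw [hβ] at hm
    rw [hβ'] at hm'
    obtain ⟨w, u, v, hrep, heq⟩ := hm
    obtain ⟨w', u', v', hrep', heq'⟩ := hm'
    obtain ⟨hw, hu, hv⟩ := hind (w' - w) (u' - u) (v' - v) (by
      have := hrep.symm.trans hrep'
      rw [sub_smul, sub_smul, sub_smul]
      linear_combination (exp := 1) -this)
    rw [sub_eq_zero] at hw hu hv
    subst hw hu hv
    have hv0 : v' ≠ 0 := by
      rintro rfl
      obtain ⟨-, -, h1⟩ := hind3 w' u' (-1) (by rw [hrep]; module)
      norm_num at h1
    refine ⟨w', u', v', hv0, hrep, ?_⟩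
    have : v' * (w' * (c - c') + u' * (q - q')) = 0 := by linear_combination heq - heq'
    exact (mul_eq_zero.mp this).resolve_left hv0
  obtain ⟨w, u, v, hv, hrep, heq⟩ := hoff k hik hk hk'
  have hjO := mem_conicOf.mp hj
  have hkO := mem_conicOf.mp hk
  have hlO := mem_conicOf.mp hl
  obtain ⟨w', u', v', hv', hrep', heq'⟩ := hoff l hil hl hl'
  have hind4 := hQ.linearIndependent_triple hjO.1 hjO.2 hkO.1 hkO.2 hlO.2
    (linearIndependent_rep (hP.ne hjk)) (linearIndependent_rep (hP.ne hjl))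
    (linearIndependent_rep (hP.ne hkl))
  rw [linearIndependent_triple_iff] at hind4
  -- If the determinant vanished, `P k` and `P l` would have the same projection from `P j`, making
  -- the three points collinear.
  have hdet : w * u' - w' * u ≠ 0 := by
    intro hdet
    obtain ⟨-, hu', hu⟩ := hind4 (-(u' * v - u * v')) u' (-u) (by
      rw [hrep, hrep']
      have : (u' * w - u * w') • O.rep = 0 := by
        rw [show u' * w - u * w' = 0 by linear_combination hdet, zero_smul]
      rw [← this]
      module)
    obtain ⟨-, hw', hw⟩ := hind4 (-(w' * v - w * v')) w' (-w) (by
      rw [hrep, hrep']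
      have : (w' * u - w * u') • (P i).rep = 0 := by
        rw [show w' * u - w * u' = 0 by linear_combination -hdet, zero_smul]
      rw [← this]
      module)
    rw [neg_eq_zero] at hu hw
    subst hu hw
    obtain ⟨h1, h2, -⟩ := hind4 v (-1) 0 (by rw [hrep]; module)
    norm_num at h2
  have hc : c - c' = 0 := by
    have : (w * u' - w' * u) * (c - c') = 0 := by linear_combination u' * heq - u * heq'
    exact (mul_eq_zero.mp this).resolve_left hdet
  have hq : q - q' = 0 := by
    have : (w * u' - w' * u) * (q - q') = 0 := by linear_combination w * heq' - w' * heq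
    exact (mul_eq_zero.mp this).resolve_left hdet
  rw [hβ, hβ', sub_eq_zero.mp hc, sub_eq_zero.mp hq]

omit hO hP in
theorem card_add_missed (β : Set P3) [DecidablePred fun i => P i ∈ β] :
    (Finset.univ.filter fun i => P i ∈ β).card + (missed P β).card = 6 := by
  have := Finset.card_filter_add_card_filter_not (s := (Finset.univ : Finset (Fin 6)))
    (fun i => P i ∈ β)
  rw [show missed P β = Finset.univ.filter fun i => ¬ P i ∈ β by ext; simp [mem_missed]]
  simpa using this

/-- If `n` of the `P i` lie on the conic, `6 - n` are missed. The four bounds treat `n = 0`, `n = 1,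
2`, `n = 3, 4` and `n ≥ 5`. -/
theorem genericallyFinite_lineFree : GenericallyFinite (lineFreeConics O P) := by
  classical
  have hfin := Set.finite_iUnion fun f : Fin 4 ↪ Fin 6 =>
    have hf : ∀ a b : Fin 4, a ≠ b → f a ≠ f b := fun a b => f.injective.ne
    (subsingleton_lineFree O P hO hP (hf 0 1 (by decide)) (hf 0 2 (by decide))
      (hf 0 3 (by decide)) (hf 1 2 (by decide)) (hf 1 3 (by decide)) (hf 2 3 (by decide))).finite
  refine ((genericallyFinite_lineFree_of_six O P).union
    ((genericallyFinite_lineFree_of_four O P hO).union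
      ((genericallyFinite_lineFree_of_two O P hO hP).union
        (GenericallyFinite.of_finite hfin)))).mono ?_
  intro Y β hβ
  have hcard := card_add_missed P β
  set s := Finset.univ.filter fun i => P i ∈ β with hs
  have hmem : ∀ i ∈ s, P i ∈ β := fun i hi => (Finset.mem_filter.mp hi).2
  by_cases h6 : 6 ≤ (missed P β).card
  · exact Or.inl ⟨hβ, h6⟩
  by_cases h4 : 4 ≤ (missed P β).card
  · obtain ⟨i, hi⟩ := Finset.card_pos.mp (show 0 < s.card by omega)
    exact Or.inr (Or.inl ⟨hβ, h4, i, hmem i hi⟩)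
  by_cases h2 : 2 ≤ (missed P β).card
  · obtain ⟨i, hi, j, hj, hij⟩ := Finset.one_lt_card.mp (show 1 < s.card by omega)
    exact Or.inr (Or.inr (Or.inl ⟨hβ, h2, i, j, hij, hmem i hi, hmem j hj⟩))
  · refine Or.inr (Or.inr (Or.inr (Set.mem_iUnion.mpr
      ⟨(s.orderEmbOfCardLe (k := 4) (by omega)).toEmbedding, hβ.1, hβ.2.1, ?_⟩)))
    exact ⟨hmem _ (Finset.orderEmbOfCardLe_mem ..), hmem _ (Finset.orderEmbOfCardLe_mem ..),
      hmem _ (Finset.orderEmbOfCardLe_mem ..), hmem _ (Finset.orderEmbOfCardLe_mem ..)⟩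

end

/-! ### Conics that contain a line -/

theorem exists_submodule_of_equation {x y z : Fin 4 → ℂ} (hind : LinearIndependent ℂ ![x, y, z])
    {a b c : ℂ} (ha : a ≠ 0) :
    ∃ E : Submodule ℂ (Fin 4 → ℂ), Module.finrank ℂ E = 2 ∧ E ≤ Submodule.span ℂ {x, y, z} ∧
      ∀ r s t : ℂ, r • x + s • y + t • z ∈ E ↔ a * r + b * s + c * t = 0 := by
  rw [linearIndependent_triple_iff] at hind
  refine ⟨Submodule.span ℂ {y - (b / a) • x, z - (c / a) • x}, ?_, ?_, ?_⟩
  · apply finrank_span_pair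
    rw [LinearIndependent.pair_iff]
    intro s t hst
    obtain ⟨-, hs, ht⟩ := hind (-(s * (b / a)) - t * (c / a)) s t (by rw [← hst]; module)
    exact ⟨hs, ht⟩
  · rw [Submodule.span_le]
    have hx : x ∈ Submodule.span ℂ {x, y, z} := Submodule.subset_span (by simp)
    have hy : y ∈ Submodule.span ℂ {x, y, z} := Submodule.subset_span (by simp)
    have hz : z ∈ Submodule.span ℂ {x, y, z} := Submodule.subset_span (by simp)
    rintro v (rfl | rfl)
    · exact Submodule.sub_mem _ hy (Submodule.smul_mem _ _ hx)
    · exact Submodule.sub_mem _ hz (Submodule.smul_mem _ _ hx)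
  · intro r s t
    rw [Submodule.mem_span_pair]
    constructor
    · rintro ⟨s', t', h⟩
      obtain ⟨h1, h2, h3⟩ := hind (r + s' * (b / a) + t' * (c / a)) (s - s') (t - t') (by
        rw [← sub_eq_zero] at h
        rw [← neg_eq_zero, ← h]; module)
      have hs : s' = s := by linear_combination -h2
      have ht : t' = t := by linear_combination -h3
      subst hs ht
      have : a * (r + s' * (b / a) + t' * (c / a)) = 0 := by rw [h1, mul_zero]
      rw [← this]
      field_simp
    · intro h
      refine ⟨s, t, ?_⟩
      have : r = -(s * (b / a)) - t * (c / a) := by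
        field_simp
        linear_combination h
      rw [this]
      module

theorem exists_submodule_of_equation' {x y z : Fin 4 → ℂ}
    (hind : LinearIndependent ℂ ![x, y, z]) {a b c : ℂ} (habc : ¬ (a = 0 ∧ b = 0 ∧ c = 0)) :
    ∃ E : Submodule ℂ (Fin 4 → ℂ), Module.finrank ℂ E = 2 ∧ E ≤ Submodule.span ℂ {x, y, z} ∧
      ∀ r s t : ℂ, r • x + s • y + t • z ∈ E ↔ a * r + b * s + c * t = 0 := by
  have hind' := linearIndependent_triple_iff.mp hind
  by_cases ha : a = 0
  · by_cases hb : b = 0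
    · have hc : c ≠ 0 := fun hc => habc ⟨ha, hb, hc⟩
      obtain ⟨E, hE, hle, h⟩ := exists_submodule_of_equation (x := z) (y := x) (z := y)
        (linearIndependent_triple_iff.mpr fun r s t hrst => by
          obtain ⟨h1, h2, h3⟩ := hind' s t r (by rw [← hrst]; abel)
          exact ⟨h3, h1, h2⟩) (b := a) (c := b) hc
      refine ⟨E, hE, hle.trans (Submodule.span_mono ?_), fun r s t => ?_⟩
      · rintro v (rfl | rfl | rfl) <;> simp
      · rw [show r • x + s • y + t • z = t • z + r • x + s • y by abel, h,
          show c * t + a * r + b * s = a * r + b * s + c * t by ring]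
    · obtain ⟨E, hE, hle, h⟩ := exists_submodule_of_equation (x := y) (y := x) (z := z)
        (linearIndependent_triple_iff.mpr fun r s t hrst => by
          obtain ⟨h1, h2, h3⟩ := hind' s r t (by rw [← hrst]; abel)
          exact ⟨h2, h1, h3⟩) (b := a) (c := c) hb
      refine ⟨E, hE, hle.trans (Submodule.span_mono ?_), fun r s t => ?_⟩
      · rintro v (rfl | rfl | rfl) <;> simp
      · rw [show r • x + s • y + t • z = s • y + r • x + t • z by abel, h,
          show b * s + a * r + c * t = a * r + b * s + c * t by ring]
  · exact exists_submodule_of_equation hind ha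

/-- A plane conic that contains a line is a union of two lines. -/
theorem conicOf_eq_union_of_line {h : Fin 4 → ℂ} {Q : QuadraticForm ℂ (Fin 4 → ℂ)} (hh : h ≠ 0)
    (hne : ∃ v, h ⬝ᵥ v = 0 ∧ Q v ≠ 0) (hQ : ¬ ContainsNoLine h Q) :
    ∃ E E' : Submodule ℂ (Fin 4 → ℂ), Module.finrank ℂ E = 2 ∧ Module.finrank ℂ E' = 2 ∧
      (∃ p, p ≠ 0 ∧ p ∈ E ∧ p ∈ E') ∧ conicOf h Q = pointsOf E ∪ pointsOf E' := by
  unfold ContainsNoLine at hQ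
  push Not at hQ
  obtain ⟨x, y, hx, qx, hy, qy, hxy, hpol⟩ := hQ
  have hE := finrank_span_pair hxy
  obtain ⟨z, hz, hzE⟩ : ∃ z ∈ planeOf h, z ∉ Submodule.span ℂ {x, y} := by
    by_contra! hcon
    have := Submodule.finrank_mono (show planeOf h ≤ Submodule.span ℂ {x, y} from hcon)
    rw [finrank_planeOf hh, hE] at this
    omega
  have hind : LinearIndependent ℂ ![x, y, z] := by
    rw [linearIndependent_triple_iff]
    rw [LinearIndependent.pair_iff] at hxy
    intro a b c habc
    have hc : c = 0 := by
      by_contra hc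
      apply hzE
      rw [Submodule.mem_span_pair]
      refine ⟨-(a / c), -(b / c), ?_⟩
      have : z = c⁻¹ • (a • x + b • y + c • z) - (a / c) • x - (b / c) • y := by
        rw [smul_add, smul_smul, smul_add, smul_smul, smul_smul, inv_mul_cancel₀ hc]
        module
      rw [this, habc]
      module
    subst hc
    obtain ⟨ha, hb⟩ := hxy a b (by simpa using habc)
    exact ⟨ha, hb, rfl⟩
  -- `Q` vanishes on the line `t = 0`, so `t` divides it; the other linear factor defines `E'`.
  have hval : ∀ r s t : ℂ, Q (r • x + s • y + t • z) = t * (QuadraticMap.polar Q x z * r +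
      QuadraticMap.polar Q y z * s + Q z * t) := by
    intro r s t
    rw [quadratic_triple, qx, qy, hpol]
    ring
  have hspan := span_triple_eq (finrank_planeOf hh) (mem_planeOf.mpr hx) (mem_planeOf.mpr hy)
    hz hind
  rw [mem_planeOf] at hz
  obtain ⟨E', hE', hle, hmem⟩ := exists_submodule_of_equation' hind
    (a := QuadraticMap.polar Q x z) (b := QuadraticMap.polar Q y z) (c := Q z) (by
      rintro ⟨h1, h2, h3⟩
      obtain ⟨v, hv, hqv⟩ := hne
      obtain ⟨r, s, t, rfl⟩ := exists_coordinates_of_mem_planeOf hh hx hy hz hind hv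
      rw [hval, h1, h2, h3] at hqv
      simp at hqv)
  rw [hspan] at hle
  have hEle : Submodule.span ℂ {x, y} ≤ planeOf h := by
    rw [Submodule.span_le]
    rintro v (rfl | rfl)
    exacts [mem_planeOf.mpr hx, mem_planeOf.mpr hy]
  refine ⟨Submodule.span ℂ {x, y}, E', hE, hE', ?_, ?_⟩
  · have h1 := Submodule.finrank_sup_add_finrank_inf_eq (Submodule.span ℂ {x, y}) E'
    have h2 := Submodule.finrank_mono (sup_le hEle hle)
    rw [finrank_planeOf hh] at h2
    have h3 : Submodule.span ℂ {x, y} ⊓ E' ≠ ⊥ := by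
      intro h0
      rw [h0, finrank_bot] at h1
      omega
    obtain ⟨p, hp, hp0⟩ := Submodule.exists_mem_ne_zero_of_ne_bot h3
    exact ⟨p, hp0, hp.1, hp.2⟩
  · ext P
    rw [mem_conicOf, Set.mem_union, mem_pointsOf, mem_pointsOf]
    constructor
    · rintro ⟨h1, h2⟩
      obtain ⟨r, s, t, hrst⟩ := exists_coordinates_of_mem_planeOf hh hx hy hz hind h1
      rw [← hrst, hval] at h2
      rcases mul_eq_zero.mp h2 with rfl | h2
      · exact Or.inl (Submodule.mem_span_pair.mpr ⟨r, s, by rw [← hrst]; simp⟩)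
      · exact Or.inr (by rw [← hrst, hmem]; exact h2)
    · rintro (h1 | h1)
      · refine ⟨mem_planeOf.mp (hEle h1), ?_⟩
        obtain ⟨r, s, hrs⟩ := Submodule.mem_span_pair.mp h1
        rw [← hrs, quadratic_pair, qx, qy, hpol]
        ring
      · have h2 := mem_planeOf.mp (hle h1)
        refine ⟨h2, ?_⟩
        obtain ⟨r, s, t, hrst⟩ := exists_coordinates_of_mem_planeOf hh hx hy hz hind h2
        rw [← hrst, hmem] at h1
        rw [← hrst, hval, h1, mul_zero]

/-! ### Charts for pairs of lines -/

/-- The vector with coordinate `1` at `k`, `s` at `l` and `t` at `m`. -/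
def directionVector (k l m : Fin 4) (s t : ℂ) : Fin 4 → ℂ :=
  Pi.single k (1 : ℂ) + s • Pi.single l (1 : ℂ) + t • Pi.single m (1 : ℂ)

theorem IsPolyMap.directionVector {σ : Type} {k l m : Fin 4} {s t : (σ → ℂ) → ℂ}
    (hs : IsPolyFun s) (ht : IsPolyFun t) :
    IsPolyMap fun x => directionVector k l m (s x) (t x) :=
  ((IsPolyMap.const _).add ((IsPolyMap.const _).smul hs)).add ((IsPolyMap.const _).smul ht)

/-- Two parameters for a line through a point. The shape of the direction vector involves only the
finite choice `k, l, m`, so `p` may itself vary with parameters. -/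
theorem exists_span_directionVector {E : Submodule ℂ (Fin 4 → ℂ)} (hE : Module.finrank ℂ E = 2)
    {p : Fin 4 → ℂ} (hp : p ≠ 0) (hpE : p ∈ E) :
    ∃ (k l m : Fin 4) (s t : ℂ), LinearIndependent ℂ ![p, directionVector k l m s t] ∧
      E = Submodule.span ℂ {p, directionVector k l m s t} := by
  obtain ⟨j, hj⟩ := Function.ne_iff.mp hp
  have hj' : p j ≠ 0 := hj
  obtain ⟨y, hyE, hy⟩ : ∃ y ∈ E, y ∉ Submodule.span ℂ {p} := by
    by_contra! hcon
    have := Submodule.finrank_mono (show E ≤ Submodule.span ℂ {p} from hcon)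
    rw [hE, finrank_span_singleton hp] at this
    omega
  -- Clearing the coordinate `j` of a second generator and scaling another coordinate to `1` leaves
  -- two free entries.
  set w := y - (y j / p j) • p with hw
  have hwE : w ∈ E := E.sub_mem hyE (E.smul_mem _ hpE)
  have hwj : w j = 0 := by
    simp only [hw, Pi.sub_apply, Pi.smul_apply, smul_eq_mul]
    field_simp
    ring
  have hw0 : w ≠ 0 := by
    intro h0
    apply hy
    rw [Submodule.mem_span_singleton]
    exact ⟨_, (sub_eq_zero.mp h0).symm⟩
  obtain ⟨k, hk⟩ := Function.ne_iff.mp hw0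
  have hk' : w k ≠ 0 := hk
  have hjk : j ≠ k := by
    rintro rfl
    exact hk hwj
  obtain ⟨l, m, hlm, hlj, hlk, hmj, hmk⟩ := exists_two_others j k hjk
  have hcov : ∀ i, i = j ∨ i = k ∨ i = l ∨ i = m := by
    intro i
    omega
  have hdir : (w k)⁻¹ • w = directionVector k l m (w l / w k) (w m / w k) := by
    funext i
    rcases hcov i with rfl | rfl | rfl | rfl
    · simp [directionVector, hwj, hjk, hlj.symm, hmj.symm]
    · simp [directionVector, hk', hlk.symm, hmk.symm]
    · simp [directionVector, hlm, hlk]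
      field_simp
    · simp [directionVector, hlm.symm, hmk]
      field_simp
  have hind : LinearIndependent ℂ ![p, directionVector k l m (w l / w k) (w m / w k)] := by
    rw [← hdir, LinearIndependent.pair_iff]
    intro s t hst
    have hs : s = 0 := by
      have := congrFun hst j
      simp [hwj] at this
      exact this.resolve_right hj'
    subst hs
    refine ⟨rfl, ?_⟩
    have := congrFun hst k
    simpa [hk'] using this
  refine ⟨k, l, m, w l / w k, w m / w k, hind, ?_⟩
  exact (span_pair_eq hE hpE (by rw [← hdir]; exact E.smul_mem _ hwE) hind).symm

/-- The points of the line through `x` and `y`, in two affine charts. -/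
def pencilPoint (j : Bool) (x y : Fin 4 → ℂ) (s : ℂ) : Fin 4 → ℂ :=
  if j then x + s • y else y

theorem IsPolyMap.pencilPoint {σ : Type} {j : Bool} {x y : (σ → ℂ) → Fin 4 → ℂ}
    {s : (σ → ℂ) → ℂ} (hx : IsPolyMap x) (hy : IsPolyMap y) (hs : IsPolyFun s) :
    IsPolyMap fun t => pencilPoint j (x t) (y t) (s t) := by
  cases j
  · simpa [_root_.pencilPoint] using hy
  · simpa [_root_.pencilPoint] using hx.add (hy.smul hs)

theorem exists_pencilPoint {E E' : Submodule ℂ (Fin 4 → ℂ)} {x y : Fin 4 → ℂ}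
    (hxy : LinearIndependent ℂ ![x, y]) (hE : Module.finrank ℂ E = 2) (hx : x ∈ E) (hy : y ∈ E)
    (h : ∃ p, p ≠ 0 ∧ p ∈ E ∧ p ∈ E') :
    ∃ (j : Bool) (s : ℂ), pencilPoint j x y s ≠ 0 ∧ pencilPoint j x y s ∈ E ∧
      pencilPoint j x y s ∈ E' := by
  obtain ⟨p, hp, hpE, hpE'⟩ := h
  have hspan := span_pair_eq hE hx hy hxy
  rw [← hspan, Submodule.mem_span_pair] at hpE
  obtain ⟨a, b, rfl⟩ := hpE
  rw [LinearIndependent.pair_iff] at hxy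
  by_cases ha : a = 0
  · subst ha
    have hb : b ≠ 0 := by
      rintro rfl
      simp at hp
    -- The chart `false` ignores its parameter; `0` is a dummy.
    refine ⟨false, 0, ?_, by simpa [pencilPoint] using hy, ?_⟩
    · intro h0
      have := (hxy 0 1 (by simpa [pencilPoint] using h0)).2
      norm_num at this
    · have := E'.smul_mem b⁻¹ hpE'
      simpa [pencilPoint, smul_smul, hb] using this
  · refine ⟨true, b / a, ?_, ?_, ?_⟩
    · intro h0
      have := (hxy 1 (b / a) (by simpa [pencilPoint] using h0)).1
      norm_num at this
    · simpa [pencilPoint] using E.add_mem hx (E.smul_mem _ hy)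
    · have := E'.smul_mem a⁻¹ hpE'
      rw [smul_add, smul_smul, smul_smul, inv_mul_cancel₀ ha, one_smul] at this
      simpa [pencilPoint, div_eq_inv_mul] using this

/-- A polynomial family of unions of two lines has generically only finitely many members that meet
the given lines. -/
theorem genericallyFinite_linePairs_family {ι δ : Type} [Fintype ι] [Fintype δ] (P : ι → P3)
    {g₁ g₂ g₁' g₂' : (δ → ℂ) → Fin 4 → ℂ} (h₁ : IsPolyMap g₁) (h₂ : IsPolyMap g₂)
    (h₁' : IsPolyMap g₁') (h₂' : IsPolyMap g₂') :
    GenericallyFinite fun Y : ι → Fin 4 → ℂ =>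
      {β : Set P3 | Fintype.card δ ≤ (missed P β).card ∧ MeetsLines P Y β ∧ ∃ t,
        β = pointsOf (Submodule.span ℂ {g₁ t, g₂ t}) ∪
          pointsOf (Submodule.span ℂ {g₁' t, g₂' t})} := by
  have key := genericallyFinite_curves (δ := δ) (κ := Bool) P
    (fun k t u v => if k then u • g₁ t + v • g₂ t else u • g₁' t + v • g₂' t)
    (fun k => by
      cases k
      · simpa using ((h₁'.reindex Sum.inl).smul (.coord _)).add
          ((h₂'.reindex Sum.inl).smul (.coord _))
      · simpa using ((h₁.reindex Sum.inl).smul (.coord _)).add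
          ((h₂.reindex Sum.inl).smul (.coord _)))
    (fun t => pointsOf (Submodule.span ℂ {g₁ t, g₂ t}) ∪
      pointsOf (Submodule.span ℂ {g₁' t, g₂' t}))
  refine key.mono ?_
  rintro Y β ⟨hcard, hmeet, t, rfl⟩
  refine ⟨hcard, hmeet, t, rfl, fun z hz hmem => ?_⟩
  rw [Set.mem_union, mk_mem_pointsOf, mk_mem_pointsOf, Submodule.mem_span_pair,
    Submodule.mem_span_pair] at hmem
  rcases hmem with ⟨u, v, h⟩ | ⟨u, v, h⟩
  · exact ⟨true, u, v, by simpa using h.symm⟩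
  · exact ⟨false, u, v, by simpa using h.symm⟩

/-! ### Parameter counts for pairs of lines -/

section

variable (O : P3) (P : Fin 6 → P3)

/-- Unions of two coplanar lines `E ∋ O` and `E'` that do not contain all points `P i` and meet the
given lines. -/
def IsLinePair (Y : Fin 6 → Fin 4 → ℂ) (E E' : Submodule ℂ (Fin 4 → ℂ)) (β : Set P3) : Prop :=
  Module.finrank ℂ E = 2 ∧ Module.finrank ℂ E' = 2 ∧ (∃ p, p ≠ 0 ∧ p ∈ E ∧ p ∈ E') ∧
    β = pointsOf E ∪ pointsOf E' ∧ O ∈ pointsOf E ∧ 1 ≤ (missed P β).card ∧ MeetsLines P Y β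

/-- Parameters: two for `E` through `O`, one for a common point on `E`, two for `E'` through it. -/
theorem genericallyFinite_linePairs_of_five :
    GenericallyFinite fun Y => {β | ∃ E E', IsLinePair O P Y E E' β ∧
      5 ≤ (missed P β).card} := by
  have key := fun (k l m k' l' m' : Fin 4) (j : Bool) =>
    genericallyFinite_linePairs_family (δ := Fin 5) P
      (g₁ := fun _ => O.rep) (g₂ := fun t => directionVector k l m (t 0) (t 1))
      (g₁' := fun t => pencilPoint j O.rep (directionVector k l m (t 0) (t 1)) (t 2))
      (g₂' := fun t => directionVector k' l' m' (t 3) (t 4))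
      (.const _) (.directionVector (.coord _) (.coord _))
      (.pencilPoint (.const _) (.directionVector (.coord _) (.coord _)) (.coord _))
      (.directionVector (.coord _) (.coord _))
  refine (GenericallyFinite.iUnion fun k => GenericallyFinite.iUnion fun l =>
    GenericallyFinite.iUnion fun m => GenericallyFinite.iUnion fun k' =>
    GenericallyFinite.iUnion fun l' => GenericallyFinite.iUnion fun m' =>
    GenericallyFinite.iUnion fun j => key k l m k' l' m' j).mono ?_
  rintro Y β ⟨E, E', ⟨hE, hE', hp, rfl, hO, -, hmeet⟩, hcard⟩
  rw [mem_pointsOf] at hO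
  obtain ⟨k, l, m, s, t, hind, rfl⟩ := exists_span_directionVector hE O.rep_nonzero hO
  obtain ⟨j, a, ha0, -, haE'⟩ := exists_pencilPoint hind hE hO
    (Submodule.subset_span (by simp)) hp
  obtain ⟨k', l', m', s', t', -, rfl⟩ := exists_span_directionVector hE' ha0 haE'
  simp only [Set.mem_iUnion]
  exact ⟨k, l, m, k', l', m', j, by simpa using hcard, hmeet, ![s, t, a, s', t'], rfl⟩

variable (hO : ∀ i, O ≠ P i) (hP : Function.Injective P)

include hO in
-- `E` is fixed by `O` and `P i`; the common point and the direction of `E'` cost one and two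
-- parameters.
theorem genericallyFinite_linePairs_of_three :
    GenericallyFinite fun Y => {β | ∃ E E', IsLinePair O P Y E E' β ∧
      3 ≤ (missed P β).card ∧ ∃ i, P i ∈ pointsOf E} := by
  have key := fun (i : Fin 6) (k l m : Fin 4) (j : Bool) =>
    genericallyFinite_linePairs_family (δ := Fin 3) P
      (g₁ := fun _ => O.rep) (g₂ := fun _ => (P i).rep)
      (g₁' := fun t => pencilPoint j O.rep (P i).rep (t 0))
      (g₂' := fun t => directionVector k l m (t 1) (t 2))
      (.const _) (.const _) (.pencilPoint (.const _) (.const _) (.coord _))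
      (.directionVector (.coord _) (.coord _))
  refine (GenericallyFinite.iUnion fun i => GenericallyFinite.iUnion fun k =>
    GenericallyFinite.iUnion fun l => GenericallyFinite.iUnion fun m =>
    GenericallyFinite.iUnion fun j => key i k l m j).mono ?_
  rintro Y β ⟨E, E', ⟨hE, hE', hp, rfl, hOE, -, hmeet⟩, hcard, i, hi⟩
  rw [mem_pointsOf] at hOE hi
  have hspan := span_pair_eq hE hOE hi (linearIndependent_rep (hO i))
  obtain ⟨j, a, ha0, -, haE'⟩ := exists_pencilPoint (linearIndependent_rep (hO i)) hE hOE hi hp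
  obtain ⟨k, l, m, s, t, -, rfl⟩ := exists_span_directionVector hE' ha0 haE'
  simp only [Set.mem_iUnion]
  exact ⟨i, k, l, m, j, by simpa using hcard, hmeet, ![a, s, t], by rw [← hspan]; rfl⟩

theorem linearIndependent_of_mem_of_notMem {E : Submodule ℂ (Fin 4 → ℂ)} {x y : Fin 4 → ℂ}
    (hx : x ∈ E) (hx0 : x ≠ 0) (hy : y ∉ E) : LinearIndependent ℂ ![y, x] := by
  rw [LinearIndependent.pair_iff]
  intro s t hst
  have hs : s = 0 := by
    by_contra hs
    apply hy
    have : y = -((t / s) • x) := by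
      have h1 : s⁻¹ • (s • y + t • x) = 0 := by rw [hst, smul_zero]
      rw [smul_add, smul_smul, smul_smul, inv_mul_cancel₀ hs, one_smul] at h1
      rw [div_eq_inv_mul]
      exact eq_neg_of_add_eq_zero_left h1
    rw [this]
    exact E.neg_mem (E.smul_mem _ hx)
  subst hs
  refine ⟨rfl, ?_⟩
  simpa [hx0] using hst

include hO in
-- `E` is fixed, and `E'` joins a given point off `E` to a point moving on `E`. The single missed
-- point in `IsLinePair` pays for this parameter.
theorem genericallyFinite_linePairs_of_both :
    GenericallyFinite fun Y => {β | ∃ E E', IsLinePair O P Y E E' β ∧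
      (∃ i, P i ∈ pointsOf E) ∧ ∃ i, P i ∈ pointsOf E' ∧ P i ∉ pointsOf E} := by
  have key := fun (i i' : Fin 6) (j : Bool) =>
    genericallyFinite_linePairs_family (δ := Fin 1) P
      (g₁ := fun _ => O.rep) (g₂ := fun _ => (P i).rep)
      (g₁' := fun _ => (P i').rep)
      (g₂' := fun t => pencilPoint j O.rep (P i).rep (t 0))
      (.const _) (.const _) (.const _) (.pencilPoint (.const _) (.const _) (.coord _))
  refine (GenericallyFinite.iUnion fun i => GenericallyFinite.iUnion fun i' =>
    GenericallyFinite.iUnion fun j => key i i' j).mono ?_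
  rintro Y β ⟨E, E', ⟨hE, hE', hp, rfl, hOE, hcard, hmeet⟩, ⟨i, hi⟩, i', hi', hiE⟩
  rw [mem_pointsOf] at hOE hi hi' hiE
  have hspan := span_pair_eq hE hOE hi (linearIndependent_rep (hO i))
  obtain ⟨j, a, ha0, haE, haE'⟩ := exists_pencilPoint (linearIndependent_rep (hO i)) hE hOE hi hp
  have hspan' := span_pair_eq hE' hi' haE' (linearIndependent_of_mem_of_notMem haE ha0 hiE)
  simp only [Set.mem_iUnion]
  exact ⟨i, i', j, by simpa using hcard, hmeet, ![a], by rw [← hspan, ← hspan']; rfl⟩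

include hP in
-- Here `E'` is fixed and `E` joins `O` to a point moving on `E'`.
theorem genericallyFinite_linePairs_of_two :
    GenericallyFinite fun Y => {β | ∃ E E', IsLinePair O P Y E E' β ∧
      O ∉ pointsOf E' ∧ ∃ i i', i ≠ i' ∧ P i ∈ pointsOf E' ∧ P i' ∈ pointsOf E'} := by
  have key := fun (i i' : Fin 6) (j : Bool) =>
    genericallyFinite_linePairs_family (δ := Fin 1) P
      (g₁ := fun _ => O.rep) (g₂ := fun t => pencilPoint j (P i).rep (P i').rep (t 0))
      (g₁' := fun _ => (P i).rep) (g₂' := fun _ => (P i').rep)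
      (.const _) (.pencilPoint (.const _) (.const _) (.coord _)) (.const _) (.const _)
  refine (GenericallyFinite.iUnion fun i => GenericallyFinite.iUnion fun i' =>
    GenericallyFinite.iUnion fun j => key i i' j).mono ?_
  rintro Y β ⟨E, E', ⟨hE, hE', ⟨p, hp0, hpE, hpE'⟩, rfl, hOE, hcard, hmeet⟩, hOE', i, i', hii', hi,
    hi'⟩
  rw [mem_pointsOf] at hOE hi hi' hOE'
  have hind := linearIndependent_rep (hP.ne hii')
  have hspan := span_pair_eq hE' hi hi' hind
  obtain ⟨j, a, ha0, haE', haE⟩ := exists_pencilPoint hind hE' hi hi' ⟨p, hp0, hpE', hpE⟩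
  have hspan' := span_pair_eq hE hOE haE (linearIndependent_of_mem_of_notMem haE' ha0 hOE')
  simp only [Set.mem_iUnion]
  exact ⟨i, i', j, by simpa using hcard, hmeet, ![a], by rw [← hspan, ← hspan']; rfl⟩

include hO hP in
theorem genericallyFinite_linePairs
    (hfive : ∀ E : Submodule ℂ (Fin 4 → ℂ), Module.finrank ℂ E = 2 → O ∈ pointsOf E →
      {i | P i ∈ pointsOf E}.ncard ≤ 3) :
    GenericallyFinite fun Y => {β | ∃ E E', IsLinePair O P Y E E' β} := by
  classical
  refine ((genericallyFinite_linePairs_of_five O P).union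
    ((genericallyFinite_linePairs_of_three O P hO).union
      ((genericallyFinite_linePairs_of_both O P hO).union
        (genericallyFinite_linePairs_of_two O P hP)))).mono ?_
  have hcard : ∀ E : Submodule ℂ (Fin 4 → ℂ), Module.finrank ℂ E = 2 → O ∈ pointsOf E →
      (Finset.univ.filter fun i => P i ∈ pointsOf E).card ≤ 3 := by
    intro E hE hOE
    have := hfive E hE hOE
    rwa [Set.ncard_eq_toFinset_card', Set.toFinset_ofPred] at this
  -- If `E` contains every `P i` on the pair, these number at most three by `hfive`, so at least
  -- three are missed.
  have single : ∀ {Y E E' β}, IsLinePair O P Y E E' β → (∃ i, P i ∈ pointsOf E) →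
      (∀ i, P i ∈ pointsOf E' → P i ∈ pointsOf E) → 3 ≤ (missed P β).card := by
    intro Y E E' β hβ _ hsub
    have h1 := hcard E hβ.1 hβ.2.2.2.2.1
    have h2 := card_add_missed P β
    have h3 : (Finset.univ.filter fun i => P i ∈ β) ⊆
        Finset.univ.filter fun i => P i ∈ pointsOf E := by
      intro i hi
      rw [Finset.mem_filter] at hi ⊢
      refine ⟨hi.1, ?_⟩
      have h4 := hi.2
      rw [hβ.2.2.2.1] at h4
      exact h4.elim id (hsub i)
    have h5 := Finset.card_le_card h3
    omega
  rintro Y β ⟨E, E', hβ⟩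
  by_cases hA : ∃ i, P i ∈ pointsOf E
  · by_cases hB : ∃ i, P i ∈ pointsOf E' ∧ P i ∉ pointsOf E
    · exact Or.inr (Or.inr (Or.inl ⟨E, E', hβ, hA, hB⟩))
    · push Not at hB
      exact Or.inr (Or.inl ⟨E, E', hβ, single hβ hA hB, hA⟩)
  · push Not at hA
    by_cases hB : 1 < (Finset.univ.filter fun i => P i ∈ pointsOf E').card
    · obtain ⟨i, hi, i', hi', hii'⟩ := Finset.one_lt_card.mp hB
      rw [Finset.mem_filter] at hi hi'
      by_cases hOE' : O ∈ pointsOf E'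
      -- Both lines pass through `O`, so they can be exchanged; then all the points on the pair lie
      -- on its first line.
      · have hβ' : IsLinePair O P Y E' E β := by
          obtain ⟨h1, h2, ⟨p, hp0, hpE, hpE'⟩, h4, h5, h6, h7⟩ := hβ
          exact ⟨h2, h1, ⟨p, hp0, hpE', hpE⟩, by rw [h4, Set.union_comm], hOE', h6, h7⟩
        exact Or.inr (Or.inl ⟨E', E, hβ', single hβ' ⟨i, hi.2⟩ fun i hi => absurd hi (hA i),
          i, hi.2⟩)
      · exact Or.inr (Or.inr (Or.inr ⟨E, E', hβ, hOE', i, i', hii', hi.2, hi'.2⟩))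
    · refine Or.inl ⟨E, E', hβ, ?_⟩
      have h2 := card_add_missed P β
      have h3 : (Finset.univ.filter fun i => P i ∈ β) ⊆
          Finset.univ.filter fun i => P i ∈ pointsOf E' := by
        intro i hi
        rw [Finset.mem_filter] at hi ⊢
        refine ⟨hi.1, ?_⟩
        have h4 := hi.2
        rw [hβ.2.2.2.1] at h4
        exact h4.resolve_left (hA i)
      have h5 := Finset.card_le_card h3
      omega

/-! ### All conics, and the passage from vectors to lines -/

include hO hP in
/-- For generic vectors `Y i`, only finitely many conics through `O` meet the lines through `P i`
and `Y i`. -/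
theorem genericallyFinite_conics
    (hred : ¬ ∃ β : Set P3, IsReducibleConic β ∧ O ∈ β ∧ ∀ i, P i ∈ β)
    (hfive : ∀ E : Submodule ℂ (Fin 4 → ℂ), Module.finrank ℂ E = 2 → O ∈ pointsOf E →
      {i | P i ∈ pointsOf E}.ncard ≤ 3) :
    GenericallyFinite fun Y => {β | IsConic β ∧ O ∈ β ∧ MeetsLines P Y β} := by
  refine ((genericallyFinite_lineFree O P hO hP).union
    (genericallyFinite_linePairs O P hO hP hfive)).mono ?_
  rintro Y β ⟨hconic, hOβ, hmeet⟩
  obtain ⟨h, Q, hh, hne, hβ⟩ := id hconic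
  replace hβ : β = conicOf h Q := hβ
  by_cases hQ : ContainsNoLine h Q
  · exact Or.inl ⟨⟨h, Q, hh, hQ, hβ⟩, hOβ, hmeet⟩
  · obtain ⟨E, E', hE, hE', hp, hEE'⟩ := conicOf_eq_union_of_line hh hne hQ
    rw [← hβ] at hEE'
    have hcard : 1 ≤ (missed P β).card := by
      rw [Nat.one_le_iff_ne_zero, Finset.card_ne_zero]
      by_contra hempty
      rw [Finset.not_nonempty_iff_eq_empty] at hempty
      refine hred ⟨β, ⟨hconic, E, E', hE, hE', hEE'⟩, hOβ, fun i => ?_⟩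
      by_contra hi
      have := mem_missed.mpr hi
      rw [hempty] at this
      simp at this
    have hO' := hOβ
    rw [hEE'] at hO'
    rcases hO' with hO' | hO'
    · exact Or.inr ⟨E, E', hE, hE', hp, hEE', hO', hcard, hmeet⟩
    · obtain ⟨p, hp0, hpE, hpE'⟩ := hp
      exact Or.inr ⟨E', E, hE', hE, ⟨p, hp0, hpE', hpE⟩, by rw [hEE', Set.union_comm], hO', hcard,
        hmeet⟩

end

theorem meetsLines_of_nonempty_inter {ι : Type} {P : ι → P3} {Y : ι → Fin 4 → ℂ} {β : Set P3}
    (h : ∀ i, (β ∩ pointsOf (Submodule.span ℂ {(P i).rep, Y i})).Nonempty) :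
    MeetsLines P Y β := by
  intro i hi
  obtain ⟨p, hpβ, hp⟩ := h i
  rw [mem_pointsOf, Submodule.mem_span_pair] at hp
  obtain ⟨a, b, hab⟩ := hp
  -- The common point differs from `P i`, which is off the curve; hence it can be scaled to occur in
  -- `Y i` with coefficient one.
  have hb : b ≠ 0 := by
    rintro rfl
    apply hi
    have : p = P i := by
      rw [← Projectivization.mk_rep p, ← Projectivization.mk_rep (P i),
        Projectivization.mk_eq_mk_iff']
      exact ⟨a, by rw [← hab]; simp⟩
    rwa [← this]
  have hz : b⁻¹ • p.rep ≠ 0 := smul_ne_zero (inv_ne_zero hb) p.rep_nonzero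
  refine ⟨-(b⁻¹ * a), b⁻¹ • p.rep, hz, ?_, ?_⟩
  · have : Projectivization.mk ℂ (b⁻¹ • p.rep) hz = p := by
      conv_rhs => rw [← Projectivization.mk_rep p]
      rw [Projectivization.mk_eq_mk_iff']
      exact ⟨b⁻¹, rfl⟩
    rwa [this]
  · rw [← hab, smul_add, smul_smul, smul_smul, inv_mul_cancel₀ hb]
    module

/-- A polynomial that does not vanish only at tuples of vectors `Y i` independent of `x i`. -/
theorem exists_polynomial_linearIndependent {ι : Type} [Fintype ι] (x : ι → Fin 4 → ℂ)
    (hx : ∀ i, x i ≠ 0) :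
    ∃ F : MvPolynomial (ι × Fin 4) ℂ, F ≠ 0 ∧ ∀ Y : ι → Fin 4 → ℂ,
      MvPolynomial.eval (fun k => Y k.1 k.2) F ≠ 0 → ∀ i, LinearIndependent ℂ ![x i, Y i] := by
  classical
  choose j hj using fun i => Function.ne_iff.mp (hx i)
  have hj' : ∀ i, x i (j i) ≠ 0 := hj
  choose l hl using fun i : ι => exists_ne (j i)
  -- A product of one `2 × 2` minor per index, each using a coordinate where `x i` is nonzero.
  refine ⟨∏ i, (MvPolynomial.C (x i (j i)) * MvPolynomial.X (i, l i) -
    MvPolynomial.C (x i (l i)) * MvPolynomial.X (i, j i)), ?_, ?_⟩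
  · rw [Finset.prod_ne_zero_iff]
    intro i _ h0
    have := congrArg (MvPolynomial.eval fun k : ι × Fin 4 => if k = (i, l i) then (1 : ℂ) else 0) h0
    simp [(hl i).symm, hj' i] at this
  · intro Y hY i
    rw [map_prod, Finset.prod_ne_zero_iff] at hY
    have h1 := hY i (Finset.mem_univ i)
    simp only [map_sub, map_mul, MvPolynomial.eval_C, MvPolynomial.eval_X] at h1
    rw [LinearIndependent.pair_iff]
    intro s t hst
    have e1 : s * x i (j i) + t * Y i (j i) = 0 := congrFun hst (j i)
    have e2 : s * x i (l i) + t * Y i (l i) = 0 := congrFun hst (l i)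
    have ht : t = 0 := by
      have : t * (x i (j i) * Y i (l i) - x i (l i) * Y i (j i)) = 0 := by
        linear_combination x i (j i) * e2 - x i (l i) * e1
      exact (mul_eq_zero.mp this).resolve_right h1
    subst ht
    refine ⟨?_, rfl⟩
    simpa [hj' i] using e1

/-- The points are `X 0, …, X 6`, and `L i` is a line through `X i.succ` for `i : Fin 6`. -/
theorem proposition4p8 (X : Fin 7 → P3) (hX : Function.Injective X)
    (hred : ¬ ∃ β : Set P3, IsReducibleConic β ∧ ∀ i, X i ∈ β)
    (hfive : ∀ E : Submodule ℂ (Fin 4 → ℂ), Module.finrank ℂ E = 2 → X 0 ∈ pointsOf E →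
      {i : Fin 7 | X i ∈ pointsOf E}.ncard ≤ 4) :
    ∃ U : Set ((i : Fin 6) → LinesThrough (X i.succ)),
      IsZariskiOpen (fun i : Fin 6 => X i.succ) U ∧ U.Nonempty ∧
        ∀ L ∈ U, {β : Set P3 | IsConic β ∧ X 0 ∈ β ∧
          ∀ i : Fin 6, (β ∩ pointsOf (L i).val).Nonempty}.Finite := by
  obtain ⟨F, hF, hfin⟩ := genericallyFinite_conics (X 0) (fun i : Fin 6 => X i.succ)
    (fun i => hX.ne (Fin.succ_ne_zero i).symm) (hX.comp (Fin.succ_injective 6))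
    (fun ⟨β, hβ, h0, hi⟩ => hred ⟨β, hβ, Fin.cases h0 hi⟩)
    (fun E hE h0 => by
      have h1 := hfive E hE h0
      have h2 : {i : Fin 7 | X i ∈ pointsOf E} =
          insert 0 (Fin.succ '' {i : Fin 6 | X i.succ ∈ pointsOf E}) := by
        ext i
        refine Fin.cases ?_ (fun i => ?_) i
        · simpa using h0
        · simp [Fin.succ_ne_zero]
      rw [h2, Set.ncard_insert_of_notMem (by simp [Fin.succ_ne_zero]),
        Set.ncard_image_of_injective _ (Fin.succ_injective 6)] at h1
      omega)
  obtain ⟨G, hG, hind⟩ := exists_polynomial_linearIndependent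
    (fun i : Fin 6 => (X i.succ).rep) fun i => (X i.succ).rep_nonzero
  -- One basic open set suffices: `F` gives finiteness, and `G` ensures that `Y i` together with the
  -- point spans `L i`.
  refine ⟨{L | ∃ H ∈ ({F * G} : Set (MvPolynomial (Fin 6 × Fin 4) ℂ)), ∃ Y : Fin 6 → Fin 4 → ℂ,
    (∀ i, Y i ∈ (L i).val) ∧ MvPolynomial.eval (fun k => Y k.1 k.2) H ≠ 0}, ⟨_, rfl⟩, ?_, ?_⟩
  · obtain ⟨y, hy⟩ : ∃ y, MvPolynomial.eval y (F * G) ≠ 0 := by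
      by_contra! hcon
      exact mul_ne_zero hF hG (MvPolynomial.funext fun y => by rw [hcon, map_zero])
    have hy' := hy
    rw [map_mul, mul_ne_zero_iff] at hy'
    have hYind := hind (fun i j => y (i, j)) hy'.2
    exact ⟨fun i => ⟨Submodule.span ℂ {(X i.succ).rep, fun j => y (i, j)},
      finrank_span_pair (hYind i), mem_pointsOf.mpr (Submodule.subset_span (by simp))⟩,
      _, rfl, fun i j => y (i, j), fun i => Submodule.subset_span (by simp), hy⟩
  · rintro L ⟨_, rfl, Y, hYL, hY⟩
    rw [map_mul, mul_ne_zero_iff] at hY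
    refine (hfin Y hY.1).subset ?_
    rintro β ⟨hβ, h0, hmeet⟩
    refine ⟨hβ, h0, meetsLines_of_nonempty_inter fun i => ?_⟩
    rw [span_pair_eq (L i).2.1 (mem_pointsOf.mp (L i).2.2) (hYL i) (hind Y hY.2 i)]
    exact hmeet i
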